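/- Let $\Omega=\{(a,b)\in\mathbb{R}^2 : a,b\in(0,1],\ a+b>1\}$ be the Farey triangle, let $T:\Omega\to\Omega$, $T(a,b)=\left(b,\left\lfloor\frac{1+a}{b}\right\rfloor b-a\right)$, be the BCZ map, and let $dm=2\,da\,db$ be the normalized Lebesgue measure on $\Omega$. For $n\ge 1$ let $0=\rho_0<\rho_1<\dots<\rho_{A_n}=1$ be the Farey sequence of order $n$, i.e. the rationals in $[0,1]$ with reduced denominator at most $n$. An excursion is a finite section $(a_i,b_i)_{i=0}^{s}$, $s\ge 1$, of a $T$-orbit in $\Omega$, that is, $(a_0,b_0)\in\Omega$ and $(a_i,b_i)=T^i(a_0,b_0)$, such that $\frac1{a_m}<\frac1{a_0}$ and $\frac1{a_m}<\frac1{a_s}$ for all $0<m<s$. It corresponds to the pair $(x,y)$ if $a_0=x$ and $a_s=y$. A function $f:\Omega\to\mathbb{R}$ is called piecewise continuous if, up to a Lebesgue null set, $\Omega$ is the union of finitely or countably many pairwise disjoint open sets on each of which $f$ is continuous. Theorem. Let $f:\Omega\to\mathbb{R}$ be bounded and piecewise continuous, and let $p,q\ge 1$ be coprime integers. Then for every $n\ge\max\{p,q\}$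 there is exactly one excursion $e\left(\frac qn,\frac pn\right)$ corresponding to $\left(\frac qn,\frac pn\right)$, the function $f$ is $m$-integrable, and $$\lim_{n\to\infty}\frac{pq}{A_n}\sum_{(a,b)\in e\left(\frac qn,\frac pn\right)}f(a,b)=\int_\Omega f\,dm,$$ where the sum runs over the points $(a_i,b_i)$, $0\le i\le s$, of the excursion. -/

import Mathlib

open MeasureTheory Filter Topology

/-- The Farey triangle `{(a, b) | a, b ∈ (0, 1], a + b > 1}`. -/
def fareyTriangle : Set (ℝ × ℝ) :=
  {x | 0 < x.1 ∧ x.1 ≤ 1 ∧ 0 < x.2 ∧ x.2 ≤ 1 ∧ 1 < x.1 + x.2}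

/-- The BCZ map `T(a, b) = (b, ⌊(1 + a) / b⌋ b - a)`. It is of interest on the Farey triangle,
which it maps to itself. -/
noncomputable def bczMap (x : ℝ × ℝ) : ℝ × ℝ :=
  (x.2, (⌊(1 + x.1) / x.2⌋ : ℝ) * x.2 - x.1)

/-- The probability measure `dm = 2 da db` on the Farey triangle. -/
noncomputable def fareyMeasure : Measure (ℝ × ℝ) :=
  (2 : ENNReal) • (volume : Measure (ℝ × ℝ)).restrict fareyTriangle

/-- The set of the fractions of the Farey sequence `0 = ρ_0 < ρ_1 < ⋯ < ρ_{A_n} = 1`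
of order `n`. -/
def fareySet (n : ℕ) : Set ℚ := {r | 0 ≤ r ∧ r ≤ 1 ∧ r.den ≤ n}

/-- The index `A_n` of the last term of the Farey sequence `(ρ_i)`, `0 ≤ i ≤ A_n`,
of order `n ≥ 1`. -/
noncomputable def fareyIndex (n : ℕ) : ℕ := (fareySet n).ncard - 1

/-- An excursion of the BCZ map: a section `(a_i, b_i) = T^i(a_0, b_0)`, `0 ≤ i ≤ s`, `s ≥ 1`,
of an orbit in the Farey triangle such that both endpoints are deeper than every point strictly
between them, the depth of `(a, b)` being `1 / a`. -/
@[ext]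
structure Excursion where
  /-- the starting point `(a_0, b_0)` -/
  start : ℝ × ℝ
  /-- the number `s` of steps -/
  len : ℕ
  start_mem : start ∈ fareyTriangle
  len_pos : 1 ≤ len
  deeper : ∀ m : ℕ, 0 < m → m < len →
    1 / (bczMap^[m] start).1 < 1 / start.1 ∧
      1 / (bczMap^[m] start).1 < 1 / (bczMap^[len] start).1

namespace Excursion

/-- The `i`-th point `(a_i, b_i)` of the excursion. -/
noncomputable def point (e : Excursion) (i : ℕ) : ℝ × ℝ := bczMap^[i] e.start

/-- The excursion goes from x-coordinate `a` to x-coordinate `b`, i.e. it is the excursion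
corresponding to the point `(a, b)` of `(0, 1]²`. -/
def Corresponds (e : Excursion) (a b : ℝ) : Prop :=
  (e.point 0).1 = a ∧ (e.point e.len).1 = b

/-- The sum of `f` over all the points `(a_i, b_i)`, `0 ≤ i ≤ s`, of the excursion. -/
noncomputable def sum (e : Excursion) (f : ℝ × ℝ → ℝ) : ℝ :=
  ∑ i ∈ Finset.range (e.len + 1), f (e.point i)

end Excursion

/-- `f` is piecewise continuous on the plane set `S`: up to a Lebesgue null set (the boundaries of
the pieces), `S` is the union of finitely or countably many pairwise disjoint open pieces on each
of which `f` is continuous. (Pieces may be empty, so finite families are included.) -/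
def PiecewiseContinuousOn (f : ℝ × ℝ → ℝ) (S : Set (ℝ × ℝ)) : Prop :=
  ∃ P : ℕ → Set (ℝ × ℝ), (∀ i, IsOpen (P i)) ∧ (∀ i, P i ⊆ S) ∧
    (∀ i j, i ≠ j → Disjoint (P i) (P j)) ∧ volume (S \ ⋃ i, P i) = 0 ∧
    ∀ i, ContinuousOn f (P i)

/-! Consecutive denominators $c, c'$ in the Farey sequence of order $n$ give the point $(c/n, c'/n)$
of the triangle, and the BCZ map moves on to the next pair. Choose $x, y$ with $yq - xp = 1$.
Starting at $x/q$, the sequence reaches $y/p$, and every denominator in between is $Uq + Wp$ with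
$U, W \ge 1$, hence larger than $p$ and $q$: this stretch is an excursion (`exists_excursion`). No
other one exists: by `det_eq_one_of_lt` the first and last vectors of any excursion form a lattice
basis, which determines the second starting coordinate modulo the first
(`Excursion.eq_of_corresponds`). Apart from its first point, the excursion therefore runs over the
Farey fractions in $(x/q, y/p]$, an interval of length $1/(pq)$ (`Excursion.sum_eq`).

It remains to see that the points coming from the fractions $z/c$ in a fixed interval are
equidistributed for $2\,da\,db$. The denominator following $z/c$ is the element of $(n-c, n]$
congruent to $-z^{-1}$ modulo $c$, so the point is the image of $(c/n, -z^{-1}/c)$ under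
`suspensionMap`. Weyl's criterion reduces the joint equidistribution of $(z/c, -z^{-1}/c)$ to
Kloosterman sums. Counting only $c \le \sigma n$ brings in $c/n$, with density $2s\,ds$, and
`suspensionMap` carries $2s\,ds\,d\varphi$ to the Farey measure (`map_suspensionMap`). A power
saving on average over the modulus suffices, so Kloosterman's elementary fourth moment replaces
Weil's bound.

Finally, equidistribution is used only as a lower bound on open sets. Applied to $f + C$ and $C - f$
on the open set where $f$ is known to be continuous, it gives both halves of the limit
(`tendsto_average`). -/

/-! ### Kloosterman sums: the fourth moment bound. -/

section Kloosterman

open Finset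

/-- The number of elements of a finite ring annihilated by `a`. -/
def annCard {R : Type*} [CommRing R] [Fintype R] [DecidableEq R] (a : R) : ℕ :=
  #{s : R | a * s = 0}

/-- A nonempty fibre is a translate of the annihilator. -/
lemma card_mul_eq_le_annCard {R : Type*} [CommRing R] [Fintype R] [DecidableEq R] (a b : R) :
    #{s : R | a * s = b} ≤ annCard a := by
  rcases Finset.eq_empty_or_nonempty ({s : R | a * s = b} : Finset R) with h | ⟨t, ht⟩
  · simp [h]
  · refine Finset.card_le_card_of_injOn (fun s => s - t) ?_ (by intro x _ y _ h; simpa using h)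
    intro s hs
    simp only [coe_filter, mem_univ, true_and, Set.mem_ofPred_eq, mem_filter] at hs ht ⊢
    rw [mul_sub, hs, ht, sub_self]

/-- Multiplication by `a` sends the annihilator of `a * b` into that of `b`, with fibres no larger
than the annihilator of `a`. -/
lemma annCard_mul_le {R : Type*} [CommRing R] [Fintype R] [DecidableEq R] (a b : R) :
    annCard (a * b) ≤ annCard a * annCard b := by
  refine Finset.card_le_mul_card_image_of_maps_to (f := fun s => a * s) ?_ _ ?_
  · intro s hs
    simp only [mem_filter, mem_univ, true_and] at hs ⊢
    rw [← hs]; ring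
  · intro c _
    refine le_trans (Finset.card_le_card ?_) (card_mul_eq_le_annCard a c)
    intro s hs
    simp only [mem_filter, mem_univ, true_and] at hs ⊢
    exact hs.2

/-- Parseval: after expanding the square, orthogonality in both variables leaves only the
coincidences of `g`. -/
lemma sum_norm_sq_addChar {R : Type*} [CommRing R] [Fintype R] [DecidableEq R]
    {ψ : AddChar R ℂ} (hψ : ψ.IsPrimitive) {ι : Type*} [Fintype ι] [DecidableEq ι]
    (g : ι → R × R) :
    ∑ a : R × R, ‖∑ i, ψ (a.1 * (g i).1 + a.2 * (g i).2)‖ ^ 2 =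
      (Fintype.card R : ℝ) ^ 2 * #{i : ι × ι | g i.1 = g i.2} := by
  have key : ∀ a : R × R, ((‖∑ i, ψ (a.1 * (g i).1 + a.2 * (g i).2)‖ ^ 2 : ℝ) : ℂ) =
      ∑ i : ι × ι, ψ (a.1 * ((g i.1).1 - (g i.2).1)) * ψ (a.2 * ((g i.1).2 - (g i.2).2)) := by
    intro a
    rw [Complex.ofReal_pow, ← Complex.mul_conj', map_sum, Finset.sum_mul_sum,
      Fintype.sum_prod_type]
    refine Finset.sum_congr rfl fun i _ => Finset.sum_congr rfl fun j _ => ?_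
    rw [← AddChar.map_neg_eq_conj, ← AddChar.map_add_eq_mul, ← AddChar.map_add_eq_mul]
    congr 1; ring
  have : ((∑ a : R × R, ‖∑ i, ψ (a.1 * (g i).1 + a.2 * (g i).2)‖ ^ 2 : ℝ) : ℂ) =
      (((Fintype.card R : ℝ) ^ 2 * #{i : ι × ι | g i.1 = g i.2} : ℝ) : ℂ) := by
    rw [Complex.ofReal_sum, Finset.sum_congr rfl fun a _ => key a, Finset.sum_comm]
    have h2 : ∀ i : ι × ι, (∑ a : R × R, ψ (a.1 * ((g i.1).1 - (g i.2).1)) *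
        ψ (a.2 * ((g i.1).2 - (g i.2).2))) =
        if g i.1 = g i.2 then (Fintype.card R : ℂ) ^ 2 else 0 := by
      intro i
      rw [Fintype.sum_prod_type]
      dsimp only
      rw [← Finset.sum_mul_sum, AddChar.sum_mulShift _ hψ,
        AddChar.sum_mulShift _ hψ]
      by_cases h1 : (g i.1).1 = (g i.2).1 <;> by_cases h2 : (g i.1).2 = (g i.2).2 <;>
        simp [h1, h2, sub_eq_zero, Prod.ext_iff, sq]
    rw [Finset.sum_congr rfl fun i _ => h2 i, ← Finset.sum_filter, Finset.sum_const, nsmul_eq_mul]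
    push_cast; ring
  exact_mod_cast this

/-- Kloosterman sums. -/
noncomputable def kloosterman (c : ℕ) [NeZero c] (a b : ZMod c) : ℂ :=
  ∑ x : (ZMod c)ˣ, ZMod.stdAddChar (a * (x : ZMod c) + b * ((x⁻¹ : (ZMod c)ˣ) : ZMod c))

/-- Substitute $x \mapsto tx$. This invariance turns a bound for the moment into one for each
individual sum. -/
lemma kloosterman_smul (c : ℕ) [NeZero c] (a b : ZMod c) (t : (ZMod c)ˣ) :
    kloosterman c (a * t) (b * ((t⁻¹ : (ZMod c)ˣ) : ZMod c)) = kloosterman c a b := by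
  unfold kloosterman
  refine Fintype.sum_equiv (Equiv.mulLeft t) _ _ fun x => ?_
  simp only [Equiv.coe_mulLeft, mul_inv_rev, Units.val_mul]
  congr 1; ring

lemma kloosterman_comm (c : ℕ) [NeZero c] (a b : ZMod c) :
    kloosterman c a b = kloosterman c b a := by
  unfold kloosterman
  refine Fintype.sum_equiv (Equiv.inv _) _ _ fun x => ?_
  simp only [Equiv.inv_apply, inv_inv]
  congr 1; ring

lemma kloosterman_sq (c : ℕ) [NeZero c] (a b : ZMod c) :
    kloosterman c a b ^ 2 = ∑ i : (ZMod c)ˣ × (ZMod c)ˣ, ZMod.stdAddChar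
      (a * ((i.1 : ZMod c) + (i.2 : ZMod c)) +
        b * (((i.1⁻¹ : (ZMod c)ˣ) : ZMod c) + ((i.2⁻¹ : (ZMod c)ˣ) : ZMod c))) := by
  rw [kloosterman, sq, Finset.sum_mul_sum, Fintype.sum_prod_type]
  refine Finset.sum_congr rfl fun i _ => Finset.sum_congr rfl fun j _ => ?_
  rw [← AddChar.map_add_eq_mul]
  congr 1; ring

/-- The annihilator consists of multiples of `m = c / g`, so division by `m` embeds it into `range
g`. -/
lemma annCard_le_gcd (c : ℕ) [NeZero c] (a : ZMod c) : annCard a ≤ Nat.gcd a.val c := by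
  have hc : 0 < c := Nat.pos_of_ne_zero (NeZero.ne c)
  set g := Nat.gcd a.val c with hg
  have hgpos : 0 < g := Nat.gcd_pos_of_pos_right _ hc
  obtain ⟨m, hm⟩ : g ∣ c := Nat.gcd_dvd_right _ _
  obtain ⟨a', ha'⟩ : g ∣ a.val := Nat.gcd_dvd_left _ _
  have hmpos : 0 < m := Nat.pos_of_ne_zero (by rintro rfl; omega)
  have hcop : Nat.Coprime m a' := by
    have h1 : g * Nat.gcd a' m = g * 1 := by
      rw [← Nat.gcd_mul_left, ← ha', ← hm, mul_one]
    have := Nat.eq_of_mul_eq_mul_left hgpos h1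
    rw [Nat.coprime_comm]; exact this
  unfold annCard
  have : #(Finset.range g) = g := card_range g
  conv_rhs => rw [← this]
  refine Finset.card_le_card_of_injOn (fun s => s.val / m) ?_ ?_
  · intro s hs
    simp only [coe_range, Set.mem_Iio]
    rw [Nat.div_lt_iff_lt_mul hmpos, ← hm]
    exact ZMod.val_lt s
  · have hdvd : ∀ s : ZMod c, a * s = 0 → m ∣ s.val := by
      intro s hs
      have h1 : ((a.val * s.val : ℕ) : ZMod c) = 0 := by
        push_cast; rw [ZMod.natCast_zmod_val, ZMod.natCast_zmod_val, hs]
      rw [ZMod.natCast_eq_zero_iff, ha'] at h1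
      have h2 : g * m ∣ g * (a' * s.val) := by rw [← hm, ← mul_assoc]; exact h1
      exact hcop.dvd_of_dvd_mul_left (Nat.dvd_of_mul_dvd_mul_left hgpos h2)
    intro s hs t ht hst
    simp only [coe_filter, mem_univ, true_and, Set.mem_ofPred_eq] at hs ht hst
    apply ZMod.val_injective
    rw [← Nat.div_mul_cancel (hdvd s hs), ← Nat.div_mul_cancel (hdvd t ht), hst]

lemma annCard_intCast_le (c : ℕ) [NeZero c] (h : ℤ) (hh : h ≠ 0) :
    annCard (h : ZMod c) ≤ h.natAbs := by
  refine (annCard_le_gcd c _).trans (Nat.le_of_dvd (Int.natAbs_pos.mpr hh) ?_)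
  rw [← Int.natCast_dvd]
  have h1 : (((h : ZMod c).val : ℤ)) = h % c := ZMod.val_intCast h
  have h2 : ((Nat.gcd (h : ZMod c).val c : ℕ) : ℤ) ∣ h % c := by
    rw [← h1]; exact_mod_cast Nat.gcd_dvd_left _ _
  have h3 : ((Nat.gcd (h : ZMod c).val c : ℕ) : ℤ) ∣ c := by exact_mod_cast Nat.gcd_dvd_right _ _
  exact (Int.dvd_iff_dvd_of_dvd_sub (dvd_trans h3 (Int.dvd_self_sub_emod))).mpr h2

lemma card_filter_dvd_range {c d : ℕ} (hd : d ∣ c) (hc : 0 < c) :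
    #{a ∈ range c | d ∣ a} = c / d := by
  have hdpos := Nat.pos_of_dvd_of_pos hd hc
  obtain ⟨m, rfl⟩ := hd
  rw [Nat.mul_div_cancel_left _ hdpos]
  conv_rhs => rw [← card_range m]
  symm
  refine Finset.card_bij (fun j _ => d * j) ?_ ?_ ?_
  · intro j hj
    simp only [mem_range, mem_filter] at hj ⊢
    exact ⟨Nat.mul_lt_mul_of_pos_left hj hdpos, dvd_mul_right _ _⟩
  · intro i _ j _ h; exact Nat.eq_of_mul_eq_mul_left hdpos h
  · intro b hb
    simp only [mem_range, mem_filter] at hb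
    obtain ⟨h1, j, rfl⟩ := hb
    exact ⟨j, by simpa using Nat.lt_of_mul_lt_mul_left h1, rfl⟩

/-- Bound the gcd by the sum of all common divisors; each divisor `d` of `c` then contributes `d *
(c / d) = c`. -/
lemma sum_annCard_le (c : ℕ) [NeZero c] :
    ∑ a : ZMod c, annCard a ≤ c * #c.divisors := by
  have hc : 0 < c := Nat.pos_of_ne_zero (NeZero.ne c)
  calc ∑ a : ZMod c, annCard a ≤ ∑ a : ZMod c, Nat.gcd a.val c :=
        Finset.sum_le_sum fun a _ => annCard_le_gcd c a
    _ = ∑ a ∈ range c, Nat.gcd a c := by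
        refine Finset.sum_bij (fun a _ => a.val) (fun a _ => by simpa using ZMod.val_lt a)
          (fun a _ b _ h => ZMod.val_injective c h) (fun b hb => ?_) (fun a _ => rfl)
        exact ⟨(b : ZMod c), mem_univ _, ZMod.val_cast_of_lt (by simpa using hb)⟩
    _ ≤ ∑ a ∈ range c, ∑ d ∈ c.divisors with d ∣ a, d := by
        refine Finset.sum_le_sum fun a _ => ?_
        refine Finset.single_le_sum (f := fun d => d) (fun _ _ => Nat.zero_le _) ?_
        simp [Nat.gcd_dvd_left, Nat.gcd_dvd_right, hc.ne']
    _ = ∑ d ∈ c.divisors, ∑ a ∈ range c with d ∣ a, d := by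
        simp only [Finset.sum_filter]; rw [Finset.sum_comm]
    _ = ∑ d ∈ c.divisors, c := by
        refine Finset.sum_congr rfl fun d hd => ?_
        have hdc := Nat.dvd_of_mem_divisors hd
        rw [Finset.sum_const, card_filter_dvd_range hdc hc, smul_eq_mul, Nat.div_mul_cancel hdc]
    _ = c * #c.divisors := by rw [Finset.sum_const, smul_eq_mul, mul_comm]

lemma card_mul_mul_eq_zero_le (c : ℕ) [NeZero c] :
    #{x : ZMod c × ZMod c × ZMod c | x.1 * x.2.1 * x.2.2 = 0} ≤ (c * #c.divisors) ^ 2 := by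
  calc #{x : ZMod c × ZMod c × ZMod c | x.1 * x.2.1 * x.2.2 = 0}
      = ∑ a : ZMod c, ∑ b : ZMod c, annCard (a * b) := by
        rw [Finset.card_filter, Fintype.sum_prod_type]
        refine Finset.sum_congr rfl fun a _ => ?_
        rw [Fintype.sum_prod_type]
        refine Finset.sum_congr rfl fun b _ => ?_
        rw [annCard, Finset.card_filter]
    _ ≤ ∑ a : ZMod c, ∑ b : ZMod c, annCard a * annCard b :=
        Finset.sum_le_sum fun a _ => Finset.sum_le_sum fun b _ => annCard_mul_le a b
    _ = (∑ a : ZMod c, annCard a) ^ 2 := by rw [sq, Finset.sum_mul_sum]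
    _ ≤ _ := Nat.pow_le_pow_left (sum_annCard_le c) 2

/-- The two equations imply $(x_1+x_2)(x_1-y_1)(x_1-y_2)=0$. Conversely, the three factors $s, a, b$
satisfy $2x_1 = s+a+b$ and determine the rest once $x_1$ is known; since 2 has at most two
annihilators, each triple is hit at most twice. -/
lemma card_add_eq_add_inv_le (c : ℕ) [NeZero c] :
    #{i : ((ZMod c)ˣ × (ZMod c)ˣ) × ((ZMod c)ˣ × (ZMod c)ˣ) |
      ((i.1.1 : ZMod c) + i.1.2,
        ((i.1.1⁻¹ : (ZMod c)ˣ) : ZMod c) + ((i.1.2⁻¹ : (ZMod c)ˣ) : ZMod c)) =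
      ((i.2.1 : ZMod c) + i.2.2,
        ((i.2.1⁻¹ : (ZMod c)ˣ) : ZMod c) + ((i.2.2⁻¹ : (ZMod c)ˣ) : ZMod c))} ≤
      2 * (c * #c.divisors) ^ 2 := by
  refine le_trans (Finset.card_le_mul_card_image_of_maps_to
    (t := {x : ZMod c × ZMod c × ZMod c | x.1 * x.2.1 * x.2.2 = 0})
    (f := fun i => ((i.1.1 : ZMod c) + i.1.2, (i.1.1 : ZMod c) - i.2.1, (i.1.1 : ZMod c) - i.2.2))
    ?_ 2 ?_) (Nat.mul_le_mul_left 2 (card_mul_mul_eq_zero_le c))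
  · rintro ⟨⟨x1, x2⟩, ⟨y1, y2⟩⟩ h
    simp only [mem_filter, mem_univ, true_and, Prod.mk.injEq] at h ⊢
    obtain ⟨h1, h2⟩ := h
    have e : ∀ u : (ZMod c)ˣ, (u : ZMod c) * ((u⁻¹ : (ZMod c)ˣ) : ZMod c) = 1 := fun u => by simp
    have h3 : ((x1 : ZMod c) + x2) * (y1 * y2) = (y1 + y2) * (x1 * x2) := by
      linear_combination (x1 * x2 * y1 * y2 : ZMod c) * h2
        - (y1 * y2 * x2 : ZMod c) * e x1 - (y1 * y2 * x1 : ZMod c) * e x2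
        + (x1 * x2 * y2 : ZMod c) * e y1 + (x1 * x2 * y1 : ZMod c) * e y2
    linear_combination h3 - ((x1 : ZMod c) * x2 - (x1 + x2) * x1) * h1
  · rintro ⟨s, a, b⟩ _
    refine le_trans ?_ ((card_mul_eq_le_annCard (2 : ZMod c) (s + a + b)).trans ?_)
    · refine Finset.card_le_card_of_injOn (fun i => (i.1.1 : ZMod c)) ?_ ?_
      · rintro ⟨⟨x1, x2⟩, ⟨y1, y2⟩⟩ h
        simp only [mem_filter, mem_univ, true_and, Prod.mk.injEq, coe_filter,
          Set.mem_ofPred_eq] at h ⊢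
        obtain ⟨⟨h1, -⟩, rfl, rfl, rfl⟩ := h
        linear_combination -h1
      · rintro ⟨⟨x1, x2⟩, ⟨y1, y2⟩⟩ h ⟨⟨x1', x2'⟩, ⟨y1', y2'⟩⟩ h' hx
        simp only [mem_filter, mem_univ, true_and, Prod.mk.injEq, coe_filter,
          Set.mem_ofPred_eq] at h h' hx
        obtain ⟨-, h1, h2, h3⟩ := h
        obtain ⟨-, h1', h2', h3'⟩ := h'
        simp only [Prod.mk.injEq, Units.ext_iff]
        refine ⟨⟨hx, ?_⟩, ?_, ?_⟩
        · linear_combination h1 - h1' - hx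
        · linear_combination h2' - h2 + hx
        · linear_combination h3' - h3 + hx
    · have := annCard_intCast_le c 2 (by norm_num)
      simpa using this

/-- Parseval applied to the square of the sum, written as an exponential sum over pairs. -/
lemma sum_norm_kloosterman_pow_four_le (c : ℕ) [NeZero c] :
    ∑ a : ZMod c × ZMod c, ‖kloosterman c a.1 a.2‖ ^ 4 ≤
      2 * (c : ℝ) ^ 4 * (#c.divisors : ℝ) ^ 2 := by
  have h := sum_norm_sq_addChar (ZMod.isPrimitive_stdAddChar c)
    (fun i : (ZMod c)ˣ × (ZMod c)ˣ => ((i.1 : ZMod c) + i.2,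
        ((i.1⁻¹ : (ZMod c)ˣ) : ZMod c) + ((i.2⁻¹ : (ZMod c)ˣ) : ZMod c)))
  have h2 : ∀ a : ZMod c × ZMod c, ‖kloosterman c a.1 a.2‖ ^ 4 =
      ‖kloosterman c a.1 a.2 ^ 2‖ ^ 2 := fun a => by rw [norm_pow, ← pow_mul]
  simp only [h2, kloosterman_sq]
  rw [h, ZMod.card]
  have h3 : ((2 * (c * #c.divisors) ^ 2 : ℕ) : ℝ) = 2 * ((c : ℝ) * (#c.divisors : ℝ)) ^ 2 := by
    push_cast; ring
  calc _ ≤ (c : ℝ) ^ 2 * (2 * ((c : ℝ) * (#c.divisors : ℝ)) ^ 2) := by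
        rw [← h3]
        gcongr
        exact card_add_eq_add_inv_le c
    _ = _ := by ring

/-- In $c = \sum_{d \mid c} \varphi(d)$ each term is at most $\varphi(c)$. -/
lemma le_totient_mul_card_divisors (c : ℕ) : c ≤ c.totient * #c.divisors := by
  rcases Nat.eq_zero_or_pos c with rfl | hc
  · simp
  conv_lhs => rw [← Nat.sum_totient c]
  rw [mul_comm, ← smul_eq_mul]
  refine Finset.sum_le_card_nsmul _ _ _ fun d hd => ?_
  exact Nat.le_of_dvd (Nat.totient_pos.mpr hc) (Nat.totient_dvd_of_dvd (Nat.dvd_of_mem_divisors hd))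

/-- The pairs $(ht, kt^{-1})$, $t$ a unit, all give the same sum, and each pair arises from at most
$|h|$ values of $t$. Hence $\varphi(c)$ copies of the fourth power fit into $|h|$ times the fourth
moment. -/
lemma norm_kloosterman_pow_four_le (c : ℕ) [NeZero c] (h k : ℤ) (hh : h ≠ 0) :
    ‖kloosterman c h k‖ ^ 4 ≤ 2 * (h.natAbs : ℝ) * (c : ℝ) ^ 3 * (#c.divisors : ℝ) ^ 3 := by
  have hc : 0 < c := Nat.pos_of_ne_zero (NeZero.ne c)
  have h1 : (c.totient : ℝ) * ‖kloosterman c h k‖ ^ 4 ≤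
      (h.natAbs : ℝ) * (2 * (c : ℝ) ^ 4 * (#c.divisors : ℝ) ^ 2) := by
    calc (c.totient : ℝ) * ‖kloosterman c h k‖ ^ 4
        = ∑ t : (ZMod c)ˣ, ‖kloosterman c (h * (t : ZMod c)) (k * ((t⁻¹ : (ZMod c)ˣ) : ZMod c))‖ ^ 4 := by
          simp only [kloosterman_smul]
          rw [Finset.sum_const, nsmul_eq_mul, Finset.card_univ, ZMod.card_units_eq_totient]
      _ = ∑ a : ZMod c × ZMod c, ∑ t ∈ univ.filter (fun t : (ZMod c)ˣ =>
            ((h : ZMod c) * (t : ZMod c), (k : ZMod c) * ((t⁻¹ : (ZMod c)ˣ) : ZMod c)) = a),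
            ‖kloosterman c (h * (t : ZMod c)) (k * ((t⁻¹ : (ZMod c)ˣ) : ZMod c))‖ ^ 4 :=
          (Finset.sum_fiberwise univ (fun t : (ZMod c)ˣ => ((h : ZMod c) * (t : ZMod c),
            (k : ZMod c) * ((t⁻¹ : (ZMod c)ˣ) : ZMod c))) _).symm
      _ ≤ ∑ a : ZMod c × ZMod c, (h.natAbs : ℝ) * ‖kloosterman c a.1 a.2‖ ^ 4 := by
          refine Finset.sum_le_sum fun a _ => ?_
          rw [Finset.sum_congr rfl (g := fun _ => ‖kloosterman c a.1 a.2‖ ^ 4), Finset.sum_const,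
            nsmul_eq_mul]
          · gcongr
            refine le_trans ?_ (annCard_intCast_le c h hh)
            refine le_trans ?_ (card_mul_eq_le_annCard (h : ZMod c) a.1)
            refine Finset.card_le_card_of_injOn (fun t => (t : ZMod c)) ?_
              (fun x _ y _ hxy => Units.ext hxy)
            intro t ht
            simp only [coe_filter, mem_univ, true_and, Set.mem_ofPred_eq] at ht ⊢
            rw [← ht]
          · intro t ht
            simp only [mem_filter, mem_univ, true_and] at ht
            rw [← ht]
      _ ≤ _ := by
          rw [← Finset.mul_sum]
          gcongr
          exact sum_norm_kloosterman_pow_four_le c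
  have h2 : (c : ℝ) ≤ c.totient * #c.divisors := by exact_mod_cast le_totient_mul_card_divisors c
  have hcr : (0 : ℝ) < c := by exact_mod_cast hc
  have h3 : (c : ℝ) * ‖kloosterman c h k‖ ^ 4 ≤
      c * (2 * (h.natAbs : ℝ) * (c : ℝ) ^ 3 * (#c.divisors : ℝ) ^ 3) := by
    calc (c : ℝ) * ‖kloosterman c h k‖ ^ 4
        ≤ (c.totient * #c.divisors) * ‖kloosterman c h k‖ ^ 4 := by gcongr
      _ = #c.divisors * (c.totient * ‖kloosterman c h k‖ ^ 4) := by ring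
      _ ≤ #c.divisors * ((h.natAbs : ℝ) * (2 * (c : ℝ) ^ 4 * (#c.divisors : ℝ) ^ 2)) := by gcongr
      _ = _ := by ring
  exact le_of_mul_le_mul_left h3 hcr

lemma sum_card_divisors_le (N : ℕ) :
    ∑ c ∈ Icc 1 N, (#c.divisors : ℝ) ≤ N * (1 + Real.log N) := by
  have h1 : ∀ c ∈ Icc 1 N, (#c.divisors : ℝ) = ∑ d ∈ Icc 1 N, if d ∣ c then (1 : ℝ) else 0 := by
    intro c hc
    rw [mem_Icc] at hc
    rw [← Finset.sum_filter, Finset.sum_const, nsmul_eq_mul, mul_one]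
    congr 2
    ext d
    simp only [Nat.mem_divisors, mem_filter, mem_Icc]
    constructor
    · rintro ⟨h, -⟩
      exact ⟨⟨Nat.pos_of_dvd_of_pos h (by omega), (Nat.le_of_dvd (by omega) h).trans hc.2⟩, h⟩
    · rintro ⟨-, h⟩; exact ⟨h, by omega⟩
  rw [Finset.sum_congr rfl h1, Finset.sum_comm]
  calc ∑ d ∈ Icc 1 N, ∑ c ∈ Icc 1 N, (if d ∣ c then (1 : ℝ) else 0)
      ≤ ∑ d ∈ Icc 1 N, (N : ℝ) * (d : ℝ)⁻¹ := by
        refine Finset.sum_le_sum fun d hd => ?_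
        rw [← Finset.sum_filter, Finset.sum_const, nsmul_eq_mul, mul_one]
        have : #{c ∈ Icc 1 N | d ∣ c} = N / d := by
          have := Nat.Ioc_filter_dvd_card_eq_div N d
          rw [← this]; congr 1
        rw [this, ← div_eq_mul_inv]
        exact Nat.cast_div_le
    _ = N * (harmonic N : ℝ) := by
        rw [← Finset.mul_sum, harmonic_eq_sum_Icc]; push_cast; rfl
    _ ≤ _ := by gcongr; exact harmonic_le_one_add_log N

/-- The factors other than the power of `N` are rounded up, so that only the first moment of the
divisor function is needed afterwards. -/
lemma norm_kloosterman_le_of_le {c N : ℕ} [NeZero c] (hcN : c ≤ N) (h k : ℤ) (hh : h ≠ 0) :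
    ‖kloosterman c h k‖ ≤ (2 * (h.natAbs : ℝ)) * (N : ℝ) ^ (3 / 4 : ℝ) * #c.divisors := by
  have hc : 0 < c := Nat.pos_of_ne_zero (NeZero.ne c)
  have hh1 : (1 : ℝ) ≤ h.natAbs := by exact_mod_cast Int.natAbs_pos.mpr hh
  have hd : (1 : ℝ) ≤ #c.divisors := by
    exact_mod_cast Finset.card_pos.mpr ⟨1, Nat.one_mem_divisors.mpr hc.ne'⟩
  refine le_of_pow_le_pow_left₀ (n := 4) (by norm_num) (by positivity) ?_
  refine (norm_kloosterman_pow_four_le c h k hh).trans ?_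
  rw [mul_pow, mul_pow, ← Real.rpow_natCast ((N : ℝ) ^ (3 / 4 : ℝ)) 4, ← Real.rpow_mul (by positivity)]
  have e : ((3 / 4 : ℝ) * ((4 : ℕ) : ℝ)) = ((3 : ℕ) : ℝ) := by norm_num
  rw [e, Real.rpow_natCast]
  have hcN' : (c : ℝ) ≤ N := by exact_mod_cast hcN
  gcongr ?_ * ?_ * ?_
  · exact le_self_pow₀ (by linarith) (by norm_num)
  · exact pow_le_pow_left₀ (by positivity) hcN' 3
  · exact pow_le_pow_right₀ hd (by norm_num)

/-- Kloosterman sums are small on average over the modulus. -/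
lemma tendsto_sum_norm_kloosterman (h k : ℤ) (hhk : h ≠ 0 ∨ k ≠ 0) :
    Tendsto (fun N : ℕ => (∑ c ∈ Icc 1 N, if hc : c = 0 then 0 else
      haveI : NeZero c := ⟨hc⟩
      ‖kloosterman c h k‖) / (N : ℝ) ^ 2) atTop (𝓝 0) := by
  wlog hh : h ≠ 0 generalizing h k
  · have hk : k ≠ 0 := by tauto
    have := this k h (Or.inl hk) hk
    refine this.congr fun N => ?_
    congr 1
    refine Finset.sum_congr rfl fun c _ => ?_
    split_ifs with hc
    · rfl
    · have : NeZero c := ⟨hc⟩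
      rw [kloosterman_comm]
  -- This is the final bound $2|h| \cdot N^{3/4} \cdot N(1+\log N)$ divided by $N^2$.
  have hlim : Tendsto (fun N : ℕ => (2 * (h.natAbs : ℝ)) *
      ((N : ℝ) ^ (-(1 / 4) : ℝ) + Real.log N / (N : ℝ) ^ (1 / 4 : ℝ))) atTop (𝓝 0) := by
    have h1 : Tendsto (fun x : ℝ => x ^ (-(1 / 4) : ℝ)) atTop (𝓝 0) :=
      tendsto_rpow_neg_atTop (by norm_num)
    have h2 : Tendsto (fun x : ℝ => Real.log x / x ^ (1 / 4 : ℝ)) atTop (𝓝 0) :=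
      (isLittleO_log_rpow_atTop (by norm_num : (0 : ℝ) < 1 / 4)).tendsto_div_nhds_zero
    have h3 := ((h1.add h2).comp tendsto_natCast_atTop_atTop).const_mul (2 * (h.natAbs : ℝ))
    simpa using h3
  refine squeeze_zero' (Eventually.of_forall fun N => ?_) ?_ hlim
  · refine div_nonneg (Finset.sum_nonneg fun c _ => ?_) (by positivity)
    split_ifs
    · exact le_rfl
    · exact norm_nonneg _
  · filter_upwards [eventually_gt_atTop 0] with N hN
    have hN' : (0 : ℝ) < N := by exact_mod_cast hN
    rw [div_le_iff₀ (by positivity)]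
    calc _ ≤ ∑ c ∈ Icc 1 N, (2 * (h.natAbs : ℝ)) * (N : ℝ) ^ (3 / 4 : ℝ) * #c.divisors := by
          refine Finset.sum_le_sum fun c hc => ?_
          rw [mem_Icc] at hc
          rw [dif_neg (by omega)]
          have : NeZero c := ⟨by omega⟩
          exact norm_kloosterman_le_of_le hc.2 h k hh
      _ ≤ (2 * (h.natAbs : ℝ)) * (N : ℝ) ^ (3 / 4 : ℝ) * (N * (1 + Real.log N)) := by
          rw [← Finset.mul_sum]
          gcongr
          exact sum_card_divisors_le N
      _ = _ := by
          have e1 : (N : ℝ) ^ (-(1 / 4) : ℝ) * (N : ℝ) ^ 2 = (N : ℝ) ^ (3 / 4 : ℝ) * N := by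
            rw [← Real.rpow_natCast, ← Real.rpow_add hN', ← Real.rpow_add_one hN'.ne']
            norm_num
          have e2 : (N : ℝ) ^ 2 / (N : ℝ) ^ (1 / 4 : ℝ) = (N : ℝ) ^ (3 / 4 : ℝ) * N := by
            rw [← Real.rpow_natCast, ← Real.rpow_sub hN', ← Real.rpow_add_one hN'.ne']
            norm_num
          have : (2 * (h.natAbs : ℝ)) * ((N : ℝ) ^ (-(1 / 4) : ℝ) +
              Real.log N / (N : ℝ) ^ (1 / 4 : ℝ)) * (N : ℝ) ^ 2 =
              (2 * (h.natAbs : ℝ)) * ((N : ℝ) ^ (-(1 / 4) : ℝ) * (N : ℝ) ^ 2 +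
              Real.log N * ((N : ℝ) ^ 2 / (N : ℝ) ^ (1 / 4 : ℝ))) := by ring
          rw [this, e1, e2]; ring

end Kloosterman

/-! ### Quadratic growth of the totient sum. -/

section TotientSum

open Finset

/-- The summatory function of Euler's totient. -/
def totientSum (N : ℕ) : ℕ := ∑ c ∈ Icc 1 N, c.totient

/-- Möbius inversion, written as a sum over all `d` (the terms with `d = 0` or `d > N` vanish) to
suit dominated convergence. -/
lemma totientSum_eq_tsum (N : ℕ) :
    (totientSum N : ℝ) = ∑' d : ℕ, (ArithmeticFunction.moebius d : ℝ) *
      (((N / d : ℕ) : ℝ) * (((N / d : ℕ) : ℝ) + 1) / 2) := by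
  have h1 : ∀ n ∈ Ioc 0 N, ((n.totient : ℕ) : ℝ) =
      ((ArithmeticFunction.moebius : ArithmeticFunction ℝ) *
        ((ArithmeticFunction.id : ArithmeticFunction ℕ) : ArithmeticFunction ℝ)) n := by
    intro n hn
    have h2 := (ArithmeticFunction.sum_eq_iff_sum_mul_moebius_eq
      (f := fun n => ((n.totient : ℕ) : ℝ)) (g := fun n => (n : ℝ))).mp
      (fun n _ => by exact_mod_cast Nat.sum_totient n) n (mem_Ioc.mp hn).1
    rw [← h2, ArithmeticFunction.mul_apply]
    refine Finset.sum_congr rfl fun x _ => ?_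
    simp
  have h3 : ∀ m : ℕ, ∑ k ∈ Ioc 0 m, (k : ℝ) = (m : ℝ) * ((m : ℝ) + 1) / 2 := by
    intro m
    induction m with
    | zero => simp
    | succ m ih => rw [Finset.sum_Ioc_succ_top (Nat.zero_le m), ih]
                   push_cast; ring
  have h4 : (totientSum N : ℝ) = ∑ n ∈ Ioc 0 N, ((n.totient : ℕ) : ℝ) := by
    rw [totientSum]; push_cast; rfl
  rw [h4, Finset.sum_congr rfl h1, ArithmeticFunction.sum_Ioc_mul_eq_sum_sum,
    tsum_eq_sum (s := Ioc 0 N)]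
  · refine Finset.sum_congr rfl fun d _ => ?_
    rw [← h3]; simp
  · intro d hd
    rw [mem_Ioc, not_and_or] at hd
    rcases hd with hd | hd
    · have : d = 0 := by omega
      simp [this]
    · rw [Nat.div_eq_of_lt (by omega)]; simp

/-- Half the density `6 / π ^ 2` of the coprime pairs. -/
noncomputable def halfCoprimeDensity : ℝ :=
  ∑' d : ℕ, (ArithmeticFunction.moebius d : ℝ) * (1 / 2 * (1 / (d : ℝ) ^ 2))

lemma abs_moebius_cast_le_one (d : ℕ) : |(ArithmeticFunction.moebius d : ℝ)| ≤ 1 := by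
  exact_mod_cast ArithmeticFunction.abs_moebius_le_one (n := d)

/-- Adding $\zeta(2)/2$ makes all terms nonnegative, and the term `d = 1` equals 1; so the density
is at least $1 - \pi^2/12$. Its exact value cancels from every ratio and is never needed. -/
lemma halfCoprimeDensity_pos : 0 < halfCoprimeDensity := by
  have hz := hasSum_zeta_two
  have hs : Summable fun d : ℕ =>
      (ArithmeticFunction.moebius d : ℝ) * (1 / 2 * (1 / (d : ℝ) ^ 2)) := by
    refine Summable.of_norm_bounded hz.summable fun d => ?_
    rw [Real.norm_eq_abs, abs_mul]
    have h0 : (0 : ℝ) ≤ 1 / (d : ℝ) ^ 2 := by positivity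
    rw [abs_of_nonneg (by positivity : (0 : ℝ) ≤ 1 / 2 * (1 / (d : ℝ) ^ 2))]
    nlinarith [abs_moebius_cast_le_one d, abs_nonneg (ArithmeticFunction.moebius d : ℝ)]
  have h1 := hs.hasSum.add (hz.mul_left (1 / 2))
  have h2 := sum_le_hasSum {1} (fun d _ => by
    have h0 : (0 : ℝ) ≤ 1 / (d : ℝ) ^ 2 := by positivity
    nlinarith [(abs_le.mp (abs_moebius_cast_le_one d)).1]) h1
  simp only [sum_singleton, ArithmeticFunction.moebius_apply_one] at h2
  have h3 : Real.pi ^ 2 < 12 := by nlinarith [Real.pi_lt_d2, Real.pi_pos]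
  unfold halfCoprimeDensity
  norm_num at h2 ⊢
  linarith

/-- Dominated convergence in the Möbius sum, with bound $1/d^2$. -/
lemma tendsto_totientSum :
    Tendsto (fun N : ℕ => (totientSum N : ℝ) / (N : ℝ) ^ 2) atTop (𝓝 halfCoprimeDensity) := by
  have h := tendsto_tsum_of_dominated_convergence (𝓕 := atTop) (β := ℕ)
    (f := fun (N : ℕ) (d : ℕ) => (ArithmeticFunction.moebius d : ℝ) *
      (((N / d : ℕ) : ℝ) * (((N / d : ℕ) : ℝ) + 1) / 2) / (N : ℝ) ^ 2)
    (g := fun d => (ArithmeticFunction.moebius d : ℝ) * (1 / 2 * (1 / (d : ℝ) ^ 2)))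
    (bound := fun d : ℕ => 1 / (d : ℝ) ^ 2) hasSum_zeta_two.summable ?_ ?_
  · refine h.congr fun N => ?_
    rw [totientSum_eq_tsum, tsum_div_const]
  · intro d
    rcases Nat.eq_zero_or_pos d with rfl | hd
    · simp
    have hd' : (0 : ℝ) < d := by exact_mod_cast hd
    have h1 : Tendsto (fun N : ℕ => ((N / d : ℕ) : ℝ) / N) atTop (𝓝 (1 / (d : ℝ))) := by
      have := (tendsto_nat_floor_mul_div_atTop (R := ℝ)
        (a := 1 / (d : ℝ)) (by positivity)).comp tendsto_natCast_atTop_atTop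
      refine this.congr fun N => ?_
      simp only [Function.comp]
      rw [one_div, inv_mul_eq_div, Nat.floor_div_eq_div]
    have h2 : Tendsto (fun N : ℕ => (1 : ℝ) / N) atTop (𝓝 0) := tendsto_one_div_atTop_nhds_zero_nat
    have h3 := ((h1.mul (h1.add h2)).div_const 2).const_mul (ArithmeticFunction.moebius d : ℝ)
    have e : 1 / (d : ℝ) * (1 / (d : ℝ) + 0) / 2 = 1 / 2 * (1 / (d : ℝ) ^ 2) := by
      field_simp; ring
    rw [e] at h3
    refine h3.congr' ?_
    filter_upwards [eventually_gt_atTop 0] with N hN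
    have hN' : (0 : ℝ) < N := by exact_mod_cast hN
    field_simp
  · filter_upwards [eventually_gt_atTop 0] with N hN d
    have hN' : (0 : ℝ) < N := by exact_mod_cast hN
    rcases Nat.eq_zero_or_pos d with rfl | hd
    · simp
    have hd' : (0 : ℝ) < d := by exact_mod_cast hd
    rw [Real.norm_eq_abs, abs_div, abs_mul, abs_of_pos (by positivity : (0 : ℝ) < (N : ℝ) ^ 2),
      div_le_iff₀ (by positivity)]
    set m : ℕ := N / d with hm
    have hm1 : (m : ℝ) ≤ N / d := Nat.cast_div_le
    have hm2 : (m : ℝ) * ((m : ℝ) + 1) / 2 ≤ (m : ℝ) ^ 2 := by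
      rcases Nat.eq_zero_or_pos m with h0 | h0
      · simp [h0]
      · have : (1 : ℝ) ≤ m := by exact_mod_cast h0
        nlinarith
    rw [abs_of_nonneg (by positivity : (0 : ℝ) ≤ (m : ℝ) * ((m : ℝ) + 1) / 2)]
    calc |(ArithmeticFunction.moebius d : ℝ)| * ((m : ℝ) * ((m : ℝ) + 1) / 2)
        ≤ 1 * (m : ℝ) ^ 2 := by
          gcongr
          exact abs_moebius_cast_le_one d
      _ ≤ 1 * (N / d : ℝ) ^ 2 := by gcongr
      _ = _ := by field_simp

lemma totientSum_pos {N : ℕ} (hN : 0 < N) : 0 < totientSum N :=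
  Finset.sum_pos (fun c hc => Nat.totient_pos.mpr (by rw [mem_Icc] at hc; omega)) ⟨1, by simp; omega⟩

lemma tendsto_totientSum_floor_div {s : ℝ} (hs : 0 ≤ s) :
    Tendsto (fun N : ℕ => (totientSum ⌊s * N⌋₊ : ℝ) / totientSum N) atTop (𝓝 (s ^ 2)) := by
  rcases hs.eq_or_lt with rfl | hs'
  · simp [totientSum]
  have h1 : Tendsto (fun N : ℕ => ⌊s * N⌋₊) atTop atTop :=
    tendsto_nat_floor_atTop.comp (tendsto_natCast_atTop_atTop.const_mul_atTop hs')
  have h2 := tendsto_totientSum.comp h1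
  have h3 := ((tendsto_nat_floor_mul_div_atTop (R := ℝ) hs).comp tendsto_natCast_atTop_atTop).pow 2
  have h4 := (h2.mul h3).div tendsto_totientSum halfCoprimeDensity_pos.ne'
  rw [mul_div_assoc, mul_comm, div_mul_cancel₀ _ halfCoprimeDensity_pos.ne'] at h4
  refine h4.congr' ?_
  filter_upwards [eventually_gt_atTop 0, h1.eventually_gt_atTop 0] with N hN hN2
  have a1 : (0 : ℝ) < N := by exact_mod_cast hN
  have a2 : (0 : ℝ) < (⌊s * N⌋₊ : ℝ) := by exact_mod_cast hN2
  have a3 : (0 : ℝ) < totientSum N := by exact_mod_cast totientSum_pos hN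
  simp only [Function.comp, Pi.div_apply]
  field_simp

end TotientSum

/-! ### Weyl's criterion: equidistribution of the points $(x/c, -x^{-1}/c)$. -/

section Weyl

open Finset

/-- The uniform probability measure on the finite family of points `g i`, `i ∈ s`
(a Dirac mass if `s` is empty). -/
noncomputable def empiricalMeasure {ι X : Type*} [MeasurableSpace X] [Inhabited X] (s : Finset ι)
    (g : ι → X) : Measure X :=
  open Classical in
  if s.Nonempty then (#s : ENNReal)⁻¹ • ∑ i ∈ s, Measure.dirac (g i) else Measure.dirac default

instance {ι X : Type*} [MeasurableSpace X] [Inhabited X] (s : Finset ι) (g : ι → X) :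
    IsProbabilityMeasure (empiricalMeasure s g) := by
  unfold empiricalMeasure
  split_ifs with h
  · constructor
    simp only [Measure.smul_apply, Measure.coe_finsetSum, Finset.sum_apply, measure_univ,
      sum_const, smul_eq_mul, nsmul_eq_mul, mul_one]
    exact ENNReal.inv_mul_cancel (by simpa using h.ne_empty) (by simp)
  · infer_instance

lemma empiricalMeasure_apply {ι X : Type*} [MeasurableSpace X] [Inhabited X] {s : Finset ι}
    (hs : s.Nonempty) (g : ι → X) {E : Set X} (hE : MeasurableSet E) [DecidablePred (g · ∈ E)] :
    empiricalMeasure s g E = (#{i ∈ s | g i ∈ E} : ENNReal) / #s := by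
  rw [empiricalMeasure, if_pos hs]
  simp only [Measure.smul_apply, Measure.coe_finsetSum, Finset.sum_apply, smul_eq_mul,
    Measure.dirac_apply' _ hE, Set.indicator_apply, Pi.one_apply]
  rw [Finset.sum_boole, mul_comm, div_eq_mul_inv]

lemma empiricalMeasure_real {ι X : Type*} [MeasurableSpace X] [Inhabited X] {s : Finset ι}
    (hs : s.Nonempty) (g : ι → X) {E : Set X} (hE : MeasurableSet E) [DecidablePred (g · ∈ E)] :
    (empiricalMeasure s g).real E = (#{i ∈ s | g i ∈ E} : ℝ) / #s := by
  rw [Measure.real, empiricalMeasure_apply hs g hE, ENNReal.toReal_div]; simp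

lemma integral_empiricalMeasure {ι X E : Type*} [MeasurableSpace X] [MeasurableSingletonClass X]
    [Inhabited X] [NormedAddCommGroup E] [NormedSpace ℝ E] [CompleteSpace E] {s : Finset ι}
    (hs : s.Nonempty) (g : ι → X) (f : X → E) :
    ∫ x, f x ∂empiricalMeasure s g = (#s : ℝ)⁻¹ • ∑ i ∈ s, f (g i) := by
  rw [empiricalMeasure, if_pos hs, integral_smul_measure, integral_finsetSum_measure]
  · simp [integral_dirac]
  · intro i _
    exact integrable_dirac (by simp)

/-- The pairs `(c, x)` with `1 ≤ x ≤ c ≤ N` and `x` coprime to `c`: they correspond to the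
fractions `x / c` in `(0, 1]` with denominator at most `N`. -/
def coprimePairs (N : ℕ) : Finset (Σ _ : ℕ, ℕ) :=
  (Icc 1 N).sigma fun c => {x ∈ Icc 1 c | x.Coprime c}

lemma mem_coprimePairs {N : ℕ} {y : Σ _ : ℕ, ℕ} :
    y ∈ coprimePairs N ↔ 1 ≤ y.1 ∧ y.1 ≤ N ∧ 1 ≤ y.2 ∧ y.2 ≤ y.1 ∧ y.2.Coprime y.1 := by
  simp [coprimePairs, and_assoc]

/-- The representative in `(0, c]` of `-x⁻¹` modulo `c`. -/
def negInv (c x : ℕ) : ℕ := c - ((x : ZMod c)⁻¹).val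

lemma negInv_pos {c : ℕ} (hc : 0 < c) (x : ℕ) : 0 < negInv c x := by
  have : NeZero c := ⟨hc.ne'⟩
  exact Nat.sub_pos_of_lt (ZMod.val_lt _)

lemma negInv_le (c x : ℕ) : negInv c x ≤ c := Nat.sub_le _ _

lemma natCast_negInv {c : ℕ} (hc : 0 < c) (x : ℕ) :
    (negInv c x : ZMod c) = -(x : ZMod c)⁻¹ := by
  have : NeZero c := ⟨hc.ne'⟩
  rw [negInv, Nat.cast_sub (ZMod.val_lt _).le, ZMod.natCast_zmod_val]; simp

/-- The projection of the plane to the two-dimensional torus. -/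
def toTorus (x : ℝ × ℝ) : UnitAddTorus (Fin 2) := ![(x.1 : UnitAddCircle), (x.2 : UnitAddCircle)]

lemma continuous_toTorus : Continuous toTorus := by
  refine continuous_pi fun i => ?_
  fin_cases i
  · exact (AddCircle.continuous_mk' 1).comp continuous_fst
  · exact (AddCircle.continuous_mk' 1).comp continuous_snd

lemma isOpenMap_toTorus : IsOpenMap toTorus := by
  have h1 : IsOpenMap (fun x : ℝ => (x : UnitAddCircle)) := QuotientAddGroup.isOpenMap_coe
  have h2 := h1.prodMap h1
  have h3 := (Homeomorph.piFinTwo (fun _ : Fin 2 => UnitAddCircle)).symm.isOpenMap.comp h2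
  exact h3

/-- The point of the unit square attached to a pair `(c, x)`. -/
noncomputable def pairPoint (y : Σ _ : ℕ, ℕ) : ℝ × ℝ :=
  ((y.2 : ℝ) / y.1, (negInv y.1 y.2 : ℝ) / y.1)

lemma mFourier_toTorus (n : Fin 2 → ℤ) (x : ℝ × ℝ) :
    UnitAddTorus.mFourier n (toTorus x) =
      fourier (n 0) (x.1 : UnitAddCircle) * fourier (n 1) (x.2 : UnitAddCircle) := by
  simp [UnitAddTorus.mFourier, toTorus, Fin.prod_univ_two]

/-- The first coordinate $x/c$ and the second $-x^{-1}/c$ contribute the two halves of the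
Kloosterman phase, whence the sign on the second frequency. -/
lemma sum_mFourier_eq_kloosterman (c : ℕ) [NeZero c] (n : Fin 2 → ℤ) :
    ∑ x ∈ Icc 1 c with x.Coprime c, UnitAddTorus.mFourier n (toTorus (pairPoint ⟨c, x⟩)) =
      kloosterman c (n 0) (-n 1 : ℤ) := by
  have hc : 0 < c := Nat.pos_of_ne_zero (NeZero.ne c)
  have hc' : (c : ℂ) ≠ 0 := by exact_mod_cast hc.ne'
  have key : ∀ (k : ℤ) (m : ℕ), (fourier k (((m : ℝ) / c : ℝ) : UnitAddCircle) : ℂ) =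
      ZMod.stdAddChar ((k : ZMod c) * (m : ZMod c)) := by
    intro k m
    have : ((k : ZMod c) * (m : ZMod c)) = ((k * m : ℤ) : ZMod c) := by push_cast; rfl
    rw [this, ZMod.stdAddChar_coe, fourier_coe_apply]
    congr 1
    push_cast
    field_simp
  refine Finset.sum_bij (fun x hx => ZMod.unitOfCoprime x (mem_filter.mp hx).2)
    (fun _ _ => mem_univ _) ?_ ?_ ?_
  · intro x hx x' hx' h
    simp only [mem_filter, mem_Icc] at hx hx'
    have h1 : (x : ZMod c) = (x' : ZMod c) := by
      have := congrArg Units.val h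
      simpa using this
    rw [ZMod.natCast_eq_natCast_iff] at h1
    rcases hx.1.2.eq_or_lt with e | e
    · rcases hx'.1.2.eq_or_lt with e' | e'
      · omega
      · subst e
        have h2 : x' % x = 0 := by rw [← h1]; simp
        rw [Nat.mod_eq_of_lt e'] at h2; omega
    · rcases hx'.1.2.eq_or_lt with e' | e'
      · subst e'
        have h2 : x % x' = 0 := by rw [h1]; simp
        rw [Nat.mod_eq_of_lt e] at h2; omega
      · exact Nat.ModEq.eq_of_lt_of_lt h1 e e'
  · intro u _
    -- The representative is taken in `(0, c]`; `val u` itself would be 0, and outside the range,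
    -- when `c = 1`.
    have hcast : ((c - (-(u : ZMod c)).val : ℕ) : ZMod c) = u := by
      rw [Nat.cast_sub (ZMod.val_lt _).le, ZMod.natCast_zmod_val]; simp
    have hcop : (c - (-(u : ZMod c)).val).Coprime c := by
      rw [← ZMod.isUnit_iff_coprime, hcast]; exact u.isUnit
    refine ⟨c - (-(u : ZMod c)).val, ?_, ?_⟩
    · simp only [mem_filter, mem_Icc]
      exact ⟨⟨Nat.sub_pos_of_lt (ZMod.val_lt _), Nat.sub_le _ _⟩, hcop⟩
    · ext; simpa using hcast
  · intro x hx
    have hcop := (mem_filter.mp hx).2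
    rw [mFourier_toTorus, pairPoint]
    dsimp only
    rw [key, key, natCast_negInv hc, ← AddChar.map_add_eq_mul]
    congr 1
    have e1 : ((ZMod.unitOfCoprime x hcop : (ZMod c)ˣ) : ZMod c) = x := by simp
    have e2 : (((ZMod.unitOfCoprime x hcop)⁻¹ : (ZMod c)ˣ) : ZMod c) = (x : ZMod c)⁻¹ := by
      rw [← ZMod.inv_coe_unit, e1]
    rw [e1, e2]
    push_cast
    ring

/-- The zero frequency of the preceding identity counts the units. -/
lemma card_coprimePairs (N : ℕ) : #(coprimePairs N) = totientSum N := by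
  rw [coprimePairs, card_sigma, totientSum]
  refine Finset.sum_congr rfl fun c hc => ?_
  have : NeZero c := ⟨by rw [mem_Icc] at hc; omega⟩
  have h := sum_mFourier_eq_kloosterman c 0
  simp only [UnitAddTorus.mFourier_zero, ContinuousMap.one_apply, sum_const, nsmul_eq_mul,
    mul_one, kloosterman, Pi.zero_apply, neg_zero, Int.cast_zero, zero_mul, add_zero,
    AddChar.map_zero_eq_one, card_univ, ZMod.card_units_eq_totient] at h
  exact_mod_cast h

lemma coprimePairs_nonempty {N : ℕ} (hN : 0 < N) : (coprimePairs N).Nonempty := by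
  rw [← card_pos, card_coprimePairs]; exact totientSum_pos hN

lemma integral_fourier_Ioc (k : ℤ) :
    ∫ x in Set.Ioc (0 : ℝ) 1, (fourier k (x : UnitAddCircle) : ℂ) = if k = 0 then 1 else 0 := by
  split_ifs with h
  · simp [h]
  · rw [← intervalIntegral.integral_of_le zero_le_one]
    have h0 : (2 * Real.pi * Complex.I * k : ℂ) ≠ 0 := by
      have := Complex.two_pi_I_ne_zero
      exact mul_ne_zero this (by exact_mod_cast h)
    have : ∀ x : ℝ, (fourier k (x : UnitAddCircle) : ℂ) =
        Complex.exp ((2 * Real.pi * Complex.I * k) * x) := by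
      intro x; rw [fourier_coe_apply]; simp
    simp only [this]
    rw [integral_exp_mul_complex h0]
    have h1 : Complex.exp ((2 * Real.pi * Complex.I * k) * ((1 : ℝ) : ℂ)) = 1 := by
      rw [Complex.ofReal_one, mul_one, mul_comm]; exact Complex.exp_int_mul_two_pi_mul_I k
    rw [h1]; simp

/-- Lebesgue measure on the unit square. -/
noncomputable def squareMeasure : Measure (ℝ × ℝ) :=
  volume.restrict (Set.Ioc 0 1 ×ˢ Set.Ioc 0 1)

instance : IsProbabilityMeasure squareMeasure := by
  constructor
  rw [squareMeasure, Measure.restrict_apply_univ, Measure.volume_eq_prod, Measure.prod_prod]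
  simp

lemma integral_mFourier (n : Fin 2 → ℤ) :
    ∫ x, UnitAddTorus.mFourier n (toTorus x) ∂squareMeasure = if n = 0 then 1 else 0 := by
  simp only [mFourier_toTorus]
  rw [squareMeasure, Measure.volume_eq_prod, ← Measure.prod_restrict,
    integral_prod_mul (fun x : ℝ => (fourier (n 0) (x : UnitAddCircle) : ℂ))
      (fun x : ℝ => (fourier (n 1) (x : UnitAddCircle) : ℂ)),
    integral_fourier_Ioc, integral_fourier_Ioc]
  by_cases h0 : n 0 = 0 <;> by_cases h1 : n 1 = 0 <;>
    simp [h0, h1, funext_iff, Fin.forall_fin_two]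

/-- At a nonzero frequency the sum is a sum of Kloosterman sums, which is $o(N^2)$, whereas the
number of points grows like $N^2$. -/
lemma tendsto_sum_mFourier (n : Fin 2 → ℤ) :
    Tendsto (fun N : ℕ => ((totientSum N : ℝ)⁻¹ : ℂ) *
      ∑ y ∈ coprimePairs N, UnitAddTorus.mFourier n (toTorus (pairPoint y))) atTop
      (𝓝 (∫ x, UnitAddTorus.mFourier n (toTorus x) ∂squareMeasure)) := by
  rw [integral_mFourier]
  split_ifs with hn
  · refine tendsto_const_nhds.congr' ?_
    filter_upwards [eventually_gt_atTop 0] with N hN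
    have : (totientSum N : ℂ) ≠ 0 := by exact_mod_cast (totientSum_pos hN).ne'
    simp [hn, UnitAddTorus.mFourier_zero, card_coprimePairs, this]
  · have hn' : n 0 ≠ 0 ∨ -n 1 ≠ 0 := by
      by_contra hcon
      push Not at hcon
      apply hn
      ext i
      fin_cases i
      · exact hcon.1
      · simpa using hcon.2
    have h := (tendsto_sum_norm_kloosterman (n 0) (-n 1) hn').div tendsto_totientSum
      halfCoprimeDensity_pos.ne'
    rw [zero_div] at h
    refine squeeze_zero_norm' ?_ h
    filter_upwards [eventually_gt_atTop 0] with N hN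
    have hN' : (0 : ℝ) < N := by exact_mod_cast hN
    have ht : (0 : ℝ) < totientSum N := by exact_mod_cast totientSum_pos hN
    rw [Pi.div_apply, div_div_div_cancel_right₀ (by positivity), norm_mul, norm_inv,
      Complex.norm_real, Real.norm_eq_abs, abs_of_pos ht, inv_mul_eq_div]
    gcongr
    rw [coprimePairs, Finset.sum_sigma]
    refine (norm_sum_le _ _).trans (Finset.sum_le_sum fun c hc => ?_)
    have hc0 : c ≠ 0 := by rw [mem_Icc] at hc; omega
    have : NeZero c := ⟨hc0⟩
    rw [dif_neg hc0, sum_mFourier_eq_kloosterman]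

/-- Trigonometric polynomials are uniformly dense, and both sides are 1-Lipschitz in the sup norm.
-/
lemma tendsto_sum_torus (f : C(UnitAddTorus (Fin 2), ℂ)) :
    Tendsto (fun N : ℕ => ((totientSum N : ℝ)⁻¹ : ℂ) *
      ∑ y ∈ coprimePairs N, f (toTorus (pairPoint y))) atTop
      (𝓝 (∫ x, f (toTorus x) ∂squareMeasure)) := by
  have hint : ∀ f : C(UnitAddTorus (Fin 2), ℂ),
      Integrable (fun x => f (toTorus x)) squareMeasure := by
    intro f
    refine Integrable.of_bound (f.continuous.comp continuous_toTorus).aestronglyMeasurable ‖f‖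
      (Eventually.of_forall fun x => f.norm_coe_le_norm _)
  have hspan : ∀ g ∈ Submodule.span ℂ (Set.range (UnitAddTorus.mFourier (d := Fin 2))),
      Tendsto (fun N : ℕ => ((totientSum N : ℝ)⁻¹ : ℂ) *
      ∑ y ∈ coprimePairs N, g (toTorus (pairPoint y))) atTop
      (𝓝 (∫ x, g (toTorus x) ∂squareMeasure)) := by
    intro g hg
    induction hg using Submodule.span_induction with
    | mem g hg => obtain ⟨n, rfl⟩ := hg; exact tendsto_sum_mFourier n
    | zero => simp
    | add g g' _ _ h h' =>
      have := h.add h'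
      rw [← integral_add (hint g) (hint g')] at this
      refine this.congr fun N => ?_
      simp [Finset.sum_add_distrib, mul_add]
    | smul a g _ h =>
      have := h.const_mul a
      rw [← integral_const_mul] at this
      refine this.congr fun N => ?_
      simp only [ContinuousMap.smul_apply, smul_eq_mul, ← Finset.mul_sum]
      ring
  have hdense : f ∈ closure
      (Submodule.span ℂ (Set.range (UnitAddTorus.mFourier (d := Fin 2))) : Set _) := by
    have := UnitAddTorus.span_mFourier_closure_eq_top (d := Fin 2)
    rw [← Submodule.topologicalClosure_coe, this]; trivial
  rw [Metric.tendsto_atTop]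
  intro ε hε
  obtain ⟨g, hg, hfg⟩ := Metric.mem_closure_iff.mp hdense (ε / 3) (by positivity)
  obtain ⟨N₀, hN₀⟩ := Metric.tendsto_atTop.mp (hspan g hg) (ε / 3) (by positivity)
  have hpt : ∀ t, ‖f t - g t‖ ≤ ε / 3 := fun t => by
    rw [← dist_eq_norm]; exact (ContinuousMap.dist_apply_le_dist t).trans hfg.le
  refine ⟨max N₀ 1, fun N hN => ?_⟩
  have hN1 : 0 < N := by have := le_of_max_le_right hN; omega
  have ht : (0 : ℝ) < totientSum N := by exact_mod_cast totientSum_pos hN1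
  have h1 : dist (((totientSum N : ℝ)⁻¹ : ℂ) * ∑ y ∈ coprimePairs N, f (toTorus (pairPoint y)))
      (((totientSum N : ℝ)⁻¹ : ℂ) * ∑ y ∈ coprimePairs N, g (toTorus (pairPoint y))) ≤ ε / 3 := by
    rw [dist_eq_norm, ← mul_sub, ← Finset.sum_sub_distrib, norm_mul, norm_inv,
      Complex.norm_real, Real.norm_eq_abs, abs_of_pos ht, inv_mul_le_iff₀ ht]
    refine (norm_sum_le _ _).trans ((Finset.sum_le_card_nsmul _ _ _ fun y _ => hpt _).trans ?_)
    rw [card_coprimePairs, nsmul_eq_mul]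
  have h2 : dist (∫ x, g (toTorus x) ∂squareMeasure) (∫ x, f (toTorus x) ∂squareMeasure)
      ≤ ε / 3 := by
    rw [dist_comm, dist_eq_norm, ← integral_sub (hint f) (hint g)]
    refine (norm_integral_le_of_norm_le_const (Eventually.of_forall fun x => hpt _)).trans ?_
    simp
  have h3 := hN₀ N (le_of_max_le_left hN)
  calc _ ≤ _ := dist_triangle4 _ _ _ _
    _ < ε / 3 + ε / 3 + ε / 3 := add_lt_add_of_lt_of_le (add_lt_add_of_le_of_lt h1 h3) h2
    _ = ε := by ring

/-- A probability measure as a term of `ProbabilityMeasure`. -/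
def bundleProb {X : Type*} [MeasurableSpace X] (μ : Measure X) [h : IsProbabilityMeasure μ] :
    ProbabilityMeasure X :=
  ⟨μ, h⟩

@[simp]
lemma coe_bundleProb {X : Type*} [MeasurableSpace X] (μ : Measure X) [IsProbabilityMeasure μ] :
    (bundleProb μ : Measure X) = μ :=
  rfl

/-- The points `(x / c, -x⁻¹ / c)` are equidistributed in the unit square. -/
lemma tendsto_empiricalMeasure_pairPoint :
    Tendsto (fun N : ℕ => bundleProb (empiricalMeasure (coprimePairs N) pairPoint)) atTop
      (𝓝 (bundleProb squareMeasure)) := by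
  have hmeas : Measurable toTorus := continuous_toTorus.measurable
  have hT : IsProbabilityMeasure (squareMeasure.map toTorus) :=
    Measure.isProbabilityMeasure_map hmeas.aemeasurable
  have h1 : Tendsto (fun N : ℕ => bundleProb (empiricalMeasure (coprimePairs N)
      (toTorus ∘ pairPoint))) atTop
      (𝓝 (bundleProb (squareMeasure.map toTorus))) := by
    rw [ProbabilityMeasure.tendsto_iff_forall_integral_tendsto]
    intro f
    have h := tendsto_sum_torus ⟨fun t => (f t : ℂ), by fun_prop⟩
    simp only [ContinuousMap.coe_mk, integral_complex_ofReal] at h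
    have h' := (Complex.continuous_re.tendsto _).comp h
    simp only [coe_bundleProb]
    rw [integral_map hmeas.aemeasurable f.continuous.aestronglyMeasurable]
    refine Tendsto.congr' ?_ h'
    filter_upwards [eventually_gt_atTop 0] with N hN
    rw [integral_empiricalMeasure (coprimePairs_nonempty hN), card_coprimePairs]
    simp only [Function.comp, smul_eq_mul]
    rw [← Complex.ofReal_sum, ← Complex.ofReal_inv, ← Complex.ofReal_mul, Complex.ofReal_re]
  -- Going back from the torus to the square loses injectivity on the boundary only. Testing on open
  -- sets permits shrinking `G` to the open square, whose complement is null; its image is open in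
  -- the torus.
  refine tendsto_of_forall_isOpen_le_liminf' fun G hG => ?_
  set G₀ : Set (ℝ × ℝ) := G ∩ Set.Ioo 0 1 ×ˢ Set.Ioo 0 1 with hG₀
  have hG₀o : IsOpen G₀ := hG.inter (isOpen_Ioo.prod isOpen_Ioo)
  have hU : IsOpen (toTorus '' G₀) := isOpenMap_toTorus _ hG₀o
  have h2 := ProbabilityMeasure.le_liminf_measure_open_of_tendsto h1 hU
  simp only [coe_bundleProb] at h2 ⊢
  have hae : squareMeasure G ≤ squareMeasure G₀ := by
    refine measure_mono_ae ?_
    have e : squareMeasure = volume.restrict (Set.Ioo 0 1 ×ˢ Set.Ioo 0 1) := by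
      rw [squareMeasure, Measure.volume_eq_prod, ← Measure.prod_restrict, ← Measure.prod_restrict,
        Measure.restrict_congr_set (Ioo_ae_eq_Ioc (μ := volume) (a := (0 : ℝ)) (b := 1))]
    rw [e]
    filter_upwards [ae_restrict_mem (measurableSet_Ioo.prod measurableSet_Ioo)] with x hx hxG
    exact ⟨hxG, hx⟩
  calc squareMeasure G ≤ squareMeasure G₀ := hae
    _ ≤ squareMeasure.map toTorus (toTorus '' G₀) := by
        rw [Measure.map_apply hmeas hU.measurableSet]
        exact measure_mono (Set.subset_preimage_image _ _)
    _ ≤ _ := h2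
    _ ≤ _ := by
        refine liminf_le_liminf ?_
        filter_upwards [eventually_gt_atTop 0] with N hN
        classical
        rw [empiricalMeasure_apply (coprimePairs_nonempty hN) _ hU.measurableSet,
          empiricalMeasure_apply (coprimePairs_nonempty hN) _ hG.measurableSet]
        gcongr ?_ / _
        norm_cast
        refine Finset.card_le_card fun y hy => ?_
        rw [mem_filter] at hy ⊢
        refine ⟨hy.1, ?_⟩
        obtain ⟨z, ⟨hzG, hz⟩, hzy⟩ := hy.2
        obtain ⟨hy1, -, hy3, hy4, -⟩ := mem_coprimePairs.mp hy.1
        have hy1' : (0 : ℝ) < y.1 := by exact_mod_cast hy1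
        -- Hence a sample point whose projection lies in the image of `G₀` lies in `G₀` itself.
        have inj : ∀ a b : ℝ, a ∈ Set.Ioo (0 : ℝ) 1 → b ∈ Set.Ioc (0 : ℝ) 1 →
            (a : UnitAddCircle) = (b : UnitAddCircle) → a = b := by
          intro a b ha hb hab
          have := AddCircle.coe_eq_coe_iff_of_mem_Ioc (p := (1 : ℝ)) (a := 0)
            (hp := ⟨one_pos⟩) (x := a) (y := b) (by simpa using ⟨ha.1, ha.2.le⟩) (by simpa using hb)
          exact this.mp hab
        have e1 := congrFun hzy 0
        have e2 := congrFun hzy 1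
        have : z = pairPoint y := by
          refine Prod.ext (inj _ _ hz.1 ?_ e1) (inj _ _ hz.2 ?_ e2)
          · refine ⟨?_, ?_⟩
            · have : (0 : ℝ) < y.2 := by exact_mod_cast hy3
              exact div_pos this hy1'
            · exact (div_le_one hy1').mpr (by exact_mod_cast hy4)
          · refine ⟨?_, ?_⟩
            · have : (0 : ℝ) < negInv y.1 y.2 := by exact_mod_cast negInv_pos hy1 y.2
              exact div_pos this hy1'
            · exact (div_le_one hy1').mpr (by exact_mod_cast negInv_le _ _)
        rwa [← this]

end Weyl

/-! ### The change of variables from the square to the triangle. -/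

section Suspension

/-- The probability measure `2 s ds dφ` on the unit square. -/
noncomputable def suspensionMeasure : Measure (ℝ × ℝ) :=
  ((volume.restrict (Set.Ioc (0 : ℝ) 1)).withDensity fun s => ENNReal.ofReal (2 * s)).prod
    (volume.restrict (Set.Ioc (0 : ℝ) 1))

/-- The parametrization `(s, φ) ↦ (s, y)` of the Farey triangle: `y` is the element of
`(1 - s, 1]` congruent to `s φ` modulo `s`. -/
noncomputable def suspensionMap (x : ℝ × ℝ) : ℝ × ℝ :=
  (x.1, x.1 * (x.2 + (⌊1 / x.1 - x.2⌋ : ℝ)))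

lemma measurable_suspensionMap : Measurable suspensionMap := by
  unfold suspensionMap
  have h1 : Measurable fun x : ℝ × ℝ => 1 / x.1 - x.2 :=
    (measurable_const.div measurable_fst).sub measurable_snd
  have h2 : Measurable fun x : ℝ × ℝ => (⌊1 / x.1 - x.2⌋ : ℝ) := by
    have : Measurable fun n : ℤ => (n : ℝ) := measurable_from_top
    exact this.comp h1.floor
  exact measurable_fst.prodMk (measurable_fst.mul (measurable_snd.add h2))

lemma suspensionMap_snd_mem {s : ℝ} (hs : 0 < s) (φ : ℝ) :
    s * (φ + (⌊1 / s - φ⌋ : ℝ)) ∈ Set.Ioc (1 - s) 1 := by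
  have h1 := Int.floor_le (1 / s - φ)
  have h2 := Int.lt_floor_add_one (1 / s - φ)
  have e : s * (1 / s) = 1 := by field_simp
  constructor
  · nlinarith
  · nlinarith

lemma suspensionMap_snd_eq_toIocMod {s : ℝ} (hs : 0 < s) (φ : ℝ) :
    s * (φ + (⌊1 / s - φ⌋ : ℝ)) = toIocMod hs (1 - s) (s * φ) := by
  symm
  rw [toIocMod_eq_iff]
  refine ⟨by simpa using suspensionMap_snd_mem hs φ, -⌊1 / s - φ⌋, ?_⟩
  simp; ring

lemma suspensionMap_mem_fareyTriangle {x : ℝ × ℝ} (h0 : 0 < x.1) (h1 : x.1 ≤ 1) :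
    suspensionMap x ∈ fareyTriangle := by
  obtain ⟨h2, h3⟩ := suspensionMap_snd_mem h0 x.2
  refine ⟨h0, h1, ?_, h3, ?_⟩
  · change 0 < x.1 * _; linarith
  · change 1 < x.1 + x.1 * _; linarith

lemma measurableSet_fareyTriangle : MeasurableSet fareyTriangle := by
  unfold fareyTriangle
  measurability

/-- The condition depends only on $s\varphi$ modulo $s$. Both $(0, s]$ and $(1-s, 1]$ are
fundamental domains of the circle of length $s$, and the dilation $\varphi \mapsto s\varphi$
accounts for the factor $s$. -/
lemma volume_fiber_suspensionMap {s : ℝ} (hs : 0 < s) {F : Set ℝ} (hF : MeasurableSet F) :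
    ENNReal.ofReal s * volume.restrict (Set.Ioc (0 : ℝ) 1) {φ | s * (φ + (⌊1 / s - φ⌋ : ℝ)) ∈ F} =
      volume (F ∩ Set.Ioc (1 - s) 1) := by
  have : Fact (0 < s) := ⟨hs⟩
  set B : Set (AddCircle s) := {t | (AddCircle.equivIoc s (1 - s) t : ℝ) ∈ F} with hB
  have hBm : MeasurableSet B :=
    (measurable_subtype_coe.comp (AddCircle.measurableEquivIoc s (1 - s)).measurable) hF
  set D : Set ℝ := (fun y : ℝ => (y : AddCircle s)) ⁻¹' B with hD
  have hDm : MeasurableSet D := AddCircle.measurable_mk' hBm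
  have hDy : ∀ y, y ∈ D ↔ toIocMod hs (1 - s) y ∈ F := fun y => Iff.rfl
  have h0 := (AddCircle.measurePreserving_mk s 0).measure_preimage hBm.nullMeasurableSet
  have h1 := (AddCircle.measurePreserving_mk s (1 - s)).measure_preimage hBm.nullMeasurableSet
  change volume.restrict _ D = _ at h0 h1
  rw [Measure.restrict_apply hDm] at h0 h1
  rw [zero_add] at h0
  rw [sub_add_cancel] at h1
  have e1 : F ∩ Set.Ioc (1 - s) 1 = D ∩ Set.Ioc (1 - s) 1 := by
    ext y
    refine and_congr_left fun hy => ?_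
    rw [hDy, (toIocMod_eq_self hs).mpr (by simpa using hy)]
  have e2 : {φ | s * (φ + (⌊1 / s - φ⌋ : ℝ)) ∈ F} ∩ Set.Ioc 0 1 =
      (fun φ => s * φ) ⁻¹' (D ∩ Set.Ioc 0 s) := by
    ext φ
    simp only [Set.mem_inter_iff, Set.mem_ofPred_eq, Set.mem_preimage, hDy, Set.mem_Ioc]
    rw [suspensionMap_snd_eq_toIocMod hs]
    refine and_congr_right fun _ => and_congr ?_ ?_
    · exact (mul_pos_iff_of_pos_left hs).symm
    · exact (mul_le_iff_le_one_right hs).symm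
  rw [Measure.restrict_apply' measurableSet_Ioc, e2, Real.volume_preimage_mul_left hs.ne', h0,
    e1, h1, ← mul_assoc, ← ENNReal.ofReal_mul hs.le, abs_of_pos (inv_pos.mpr hs),
    mul_inv_cancel₀ hs.ne', ENNReal.ofReal_one, one_mul]

/-- Fubini over the first coordinate: the factor $s$ of the density is exactly what the fibres
absorb. -/
lemma map_suspensionMap : suspensionMeasure.map suspensionMap = fareyMeasure := by
  ext E hE
  rw [Measure.map_apply measurable_suspensionMap hE, suspensionMeasure,
    Measure.prod_apply (measurable_suspensionMap hE),
    lintegral_withDensity_eq_lintegral_mul _ (by fun_prop)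
      (measurable_measure_prodMk_left (measurable_suspensionMap hE)), fareyMeasure,
    Measure.smul_apply, Measure.restrict_apply hE, Measure.volume_eq_prod,
    Measure.prod_apply (hE.inter measurableSet_fareyTriangle), smul_eq_mul,
    ← lintegral_const_mul _
      (measurable_measure_prodMk_left (hE.inter measurableSet_fareyTriangle)),
    ← lintegral_indicator measurableSet_Ioc]
  congr 1
  ext s
  by_cases hs : s ∈ Set.Ioc (0 : ℝ) 1
  · rw [Set.indicator_of_mem hs]
    have hF : MeasurableSet (Prod.mk s ⁻¹' E) := measurable_prodMk_left hE
    have h := volume_fiber_suspensionMap hs.1 hF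
    have e1 : Prod.mk s ⁻¹' (E ∩ fareyTriangle) = Prod.mk s ⁻¹' E ∩ Set.Ioc (1 - s) 1 := by
      ext y
      simp only [Set.mem_preimage, Set.mem_inter_iff, fareyTriangle, Set.mem_ofPred_eq, Set.mem_Ioc]
      refine and_congr_right fun _ => ⟨fun h => ⟨by linarith [h.2.2.2.2], h.2.2.2.1⟩, fun h => ?_⟩
      exact ⟨hs.1, hs.2, by linarith [hs.2, h.1], h.2, by linarith [h.1]⟩
    rw [e1, ← h, Pi.mul_apply, ← mul_assoc, ENNReal.ofReal_mul (by norm_num)]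
    simp only [ENNReal.ofReal_ofNat]
    rfl
  · rw [Set.indicator_of_notMem hs]
    have e1 : Prod.mk s ⁻¹' (E ∩ fareyTriangle) = ∅ := by
      ext y
      simp only [Set.mem_preimage, Set.mem_inter_iff, fareyTriangle, Set.mem_ofPred_eq,
        Set.mem_empty_iff_false, iff_false]
      rintro ⟨-, h1, h2, -⟩
      exact hs ⟨h1, h2⟩
    rw [e1]; simp

lemma withDensity_Ioc {a b : ℝ} (ha : 0 ≤ a) (hab : a ≤ b) (hb : b ≤ 1) :
    ((volume.restrict (Set.Ioc (0 : ℝ) 1)).withDensity fun s => ENNReal.ofReal (2 * s))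
      (Set.Ioc a b) = ENNReal.ofReal (b ^ 2 - a ^ 2) := by
  rw [withDensity_apply _ measurableSet_Ioc, Measure.restrict_restrict measurableSet_Ioc,
    Set.inter_eq_left.mpr (Set.Ioc_subset_Ioc ha hb), ← ofReal_integral_eq_lintegral_ofReal]
  · rw [← intervalIntegral.integral_of_le hab, intervalIntegral.integral_const_mul, integral_id]
    congr 1; ring
  · exact (Continuous.integrableOn_Ioc (by fun_prop))
  · filter_upwards [ae_restrict_mem measurableSet_Ioc] with s hs
    have := hs.1
    simp only [Pi.zero_apply]
    linarith

lemma isProbabilityMeasure_density : IsProbabilityMeasure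
    ((volume.restrict (Set.Ioc (0 : ℝ) 1)).withDensity fun s => ENNReal.ofReal (2 * s)) := by
  constructor
  have h := withDensity_Ioc le_rfl zero_le_one le_rfl
  rw [withDensity_apply _ measurableSet_Ioc, Measure.restrict_restrict measurableSet_Ioc,
    Set.inter_self] at h
  rw [withDensity_apply _ MeasurableSet.univ, Measure.restrict_univ, h]
  simp

instance : IsProbabilityMeasure suspensionMeasure := by
  have := isProbabilityMeasure_density
  have h2 : IsProbabilityMeasure (volume.restrict (Set.Ioc (0 : ℝ) 1)) := ⟨by simp⟩
  unfold suspensionMeasure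
  infer_instance

instance : IsProbabilityMeasure fareyMeasure := by
  rw [← map_suspensionMap]
  exact Measure.isProbabilityMeasure_map measurable_suspensionMap.aemeasurable

/-- The open set on which `suspensionMap` is continuous. -/
def suspensionRegular : Set (ℝ × ℝ) :=
  {x | 0 < x.1} ∩ (fun x : ℝ × ℝ => 1 / x.1 - x.2) ⁻¹' (Set.range ((↑) : ℤ → ℝ))ᶜ

lemma continuousOn_one_div_sub :
    ContinuousOn (fun x : ℝ × ℝ => 1 / x.1 - x.2) {x | 0 < x.1} :=
  (continuousOn_const.div continuousOn_fst fun _ hx => (ne_of_gt hx)).sub continuousOn_snd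

lemma isOpen_suspensionRegular : IsOpen suspensionRegular :=
  continuousOn_one_div_sub.isOpen_inter_preimage (isOpen_lt continuous_const continuous_fst)
    Int.isClosedEmbedding_coe_real.isClosed_range.isOpen_compl

lemma continuousOn_suspensionMap : ContinuousOn suspensionMap suspensionRegular := by
  intro x hx
  refine ContinuousAt.continuousWithinAt ?_
  have hx0 : {x : ℝ × ℝ | 0 < x.1} ∈ 𝓝 x :=
    (isOpen_lt continuous_const continuous_fst).mem_nhds hx.1
  have h1 : ContinuousAt (fun x : ℝ × ℝ => 1 / x.1 - x.2) x :=
    continuousOn_one_div_sub.continuousAt hx0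
  set u : ℝ := 1 / x.1 - x.2 with hu
  have hne : (⌊u⌋ : ℝ) ≠ u := fun h => hx.2 ⟨⌊u⌋, h⟩
  have h2 : ContinuousAt (fun t : ℝ => (⌊t⌋ : ℝ)) u :=
    (continuousOn_floor ⌊u⌋).continuousAt
      (Ico_mem_nhds (lt_of_le_of_ne (Int.floor_le u) hne) (Int.lt_floor_add_one u))
  have h3 : ContinuousAt (fun x : ℝ × ℝ => (⌊1 / x.1 - x.2⌋ : ℝ)) x :=
    ContinuousAt.comp (f := fun x : ℝ × ℝ => 1 / x.1 - x.2) (x := x) h2 h1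
  exact continuousAt_fst.prodMk (continuousAt_fst.mul (continuousAt_snd.add h3))

/-- For each $s$ the excluded $\varphi$ lie in the countable set $1/s - \mathbb{Z}$. -/
lemma suspensionMeasure_compl_suspensionRegular :
    suspensionMeasure suspensionRegularᶜ = 0 := by
  rw [suspensionMeasure, Measure.measure_prod_null isOpen_suspensionRegular.measurableSet.compl]
  have hac : ((volume.restrict (Set.Ioc (0 : ℝ) 1)).withDensity fun s => ENNReal.ofReal (2 * s)) ≪
    volume.restrict (Set.Ioc (0 : ℝ) 1) := withDensity_absolutelyContinuous _ _
  refine hac.ae_le ?_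
  filter_upwards [ae_restrict_mem measurableSet_Ioc] with s hs
  refine Measure.restrict_le_self.absolutelyContinuous ?_
  refine Set.Countable.measure_zero ?_ _
  refine (Set.countable_range fun k : ℤ => 1 / s - (k : ℝ)).mono ?_
  intro φ hφ
  simp only [suspensionRegular, Set.mem_preimage, Set.mem_compl_iff, Set.mem_inter_iff,
    Set.mem_ofPred_eq, not_and, not_not] at hφ
  obtain ⟨k, hk⟩ := hφ hs.1
  exact ⟨k, by simp only at hk ⊢; rw [hk]; ring⟩

end Suspension

/-! ### Equidistribution of the Farey points over an interval. -/

section Equidistribution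

open Finset

/-- The pairs `(c, x)` with `c ≤ N` and `x / c` in `(ξ, η]`. -/
noncomputable def intervalPairs (ξ η : ℝ) (N : ℕ) : Finset (Σ _ : ℕ, ℕ) :=
  {y ∈ coprimePairs N | ((y.2 : ℝ) / y.1) ∈ Set.Ioc ξ η}

lemma squareMeasure_frontier_box (a b c d : ℝ) :
    squareMeasure (frontier (Set.Ioc a b ×ˢ Set.Ioc c d)) = 0 :=
  Measure.restrict_le_self.absolutelyContinuous
    (((convex_Ioc a b).prod (convex_Ioc c d)).addHaar_frontier _)

open Classical in
lemma tendsto_card_box_div (ξ η a b : ℝ) :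
    Tendsto (fun N : ℕ =>
      (#{y ∈ coprimePairs N | pairPoint y ∈ Set.Ioc ξ η ×ˢ Set.Ioc a b} : ℝ) / totientSum N) atTop
      (𝓝 (squareMeasure.real (Set.Ioc ξ η ×ˢ Set.Ioc a b))) := by
  have h := ProbabilityMeasure.tendsto_measure_of_null_frontier_of_tendsto'
    tendsto_empiricalMeasure_pairPoint (E := Set.Ioc ξ η ×ˢ Set.Ioc a b)
    (squareMeasure_frontier_box ξ η a b)
  have h2 := (ENNReal.tendsto_toReal (measure_ne_top _ _)).comp h
  refine Tendsto.congr' ?_ h2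
  filter_upwards [eventually_gt_atTop 0] with N hN
  have := empiricalMeasure_real (coprimePairs_nonempty hN) pairPoint
    ((measurableSet_Ioc (a := ξ) (b := η)).prod (measurableSet_Ioc (a := a) (b := b)))
  rw [card_coprimePairs] at this
  exact this

-- Equidistribution up to level $\sigma N$, normalized at level $N$: the factor $\sigma^2$ is the
-- distribution function of $c/N$.
open Classical in
lemma tendsto_card_box_floor_div (ξ η a b : ℝ) {σ : ℝ} (hσ : 0 ≤ σ) :
    Tendsto (fun N : ℕ =>
      (#{y ∈ coprimePairs ⌊σ * N⌋₊ | pairPoint y ∈ Set.Ioc ξ η ×ˢ Set.Ioc a b} : ℝ) / totientSum N)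
      atTop (𝓝 (squareMeasure.real (Set.Ioc ξ η ×ˢ Set.Ioc a b) * σ ^ 2)) := by
  rcases hσ.eq_or_lt with rfl | hσ'
  · have : coprimePairs 0 = ∅ := by
      ext y; rw [mem_coprimePairs]; simp; omega
    simp [this]
  have h1 : Tendsto (fun N : ℕ => ⌊σ * N⌋₊) atTop atTop :=
    tendsto_nat_floor_atTop.comp (tendsto_natCast_atTop_atTop.const_mul_atTop hσ')
  have h2 := ((tendsto_card_box_div ξ η a b).comp h1).mul (tendsto_totientSum_floor_div hσ)
  refine Tendsto.congr' ?_ h2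
  filter_upwards [h1.eventually_gt_atTop 0] with N hN
  have : (totientSum ⌊σ * N⌋₊ : ℝ) ≠ 0 := by exact_mod_cast (totientSum_pos hN).ne'
  simp only [Function.comp]
  field_simp

lemma squareMeasure_real_box {ξ η : ℝ} (h0 : 0 ≤ ξ) (h : ξ ≤ η) (h1 : η ≤ 1) (a b : ℝ) :
    squareMeasure.real (Set.Ioc ξ η ×ˢ Set.Ioc a b) =
      (η - ξ) * (volume.restrict (Set.Ioc (0 : ℝ) 1)).real (Set.Ioc a b) := by
  rw [squareMeasure, Measure.volume_eq_prod, ← Measure.prod_restrict, measureReal_prod_prod]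
  congr 1
  rw [measureReal_restrict_apply measurableSet_Ioc, Set.inter_eq_left.mpr
    (Set.Ioc_subset_Ioc h0 h1), Real.volume_real_Ioc_of_le h]

lemma pairPoint_mem_square {N : ℕ} {y : Σ _ : ℕ, ℕ} (hy : y ∈ coprimePairs N) :
    pairPoint y ∈ Set.Ioc (0 : ℝ) 1 ×ˢ Set.Ioc (0 : ℝ) 1 := by
  obtain ⟨hy1, -, hy3, hy4, -⟩ := mem_coprimePairs.mp hy
  have hy1' : (0 : ℝ) < y.1 := by exact_mod_cast hy1
  have hy3' : (0 : ℝ) < y.2 := by exact_mod_cast hy3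
  have hr : (0 : ℝ) < negInv y.1 y.2 := by exact_mod_cast negInv_pos hy1 y.2
  exact ⟨⟨div_pos hy3' hy1', (div_le_one hy1').mpr (by exact_mod_cast hy4)⟩,
    ⟨div_pos hr hy1', (div_le_one hy1').mpr (by exact_mod_cast negInv_le _ _)⟩⟩

lemma tendsto_card_intervalPairs_div {ξ η : ℝ} (h0 : 0 ≤ ξ) (h : ξ ≤ η) (h1 : η ≤ 1) :
    Tendsto (fun N : ℕ => (#(intervalPairs ξ η N) : ℝ) / totientSum N) atTop (𝓝 (η - ξ)) := by
  classical
  have h2 := tendsto_card_box_div ξ η 0 1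
  rw [squareMeasure_real_box h0 h h1, measureReal_restrict_apply measurableSet_Ioc,
    Set.inter_self, Real.volume_real_Ioc_of_le zero_le_one, sub_zero, mul_one] at h2
  refine h2.congr fun N => ?_
  congr 3
  refine Finset.filter_congr fun y hy => ?_
  have := pairPoint_mem_square hy
  exact ⟨fun h => h.1, fun h => ⟨h, this.2⟩⟩

lemma eventually_intervalPairs_nonempty {ξ η : ℝ} (h0 : 0 ≤ ξ) (h : ξ < η) (h1 : η ≤ 1) :
    ∀ᶠ N in atTop, (intervalPairs ξ η N).Nonempty := by
  have h2 := (tendsto_card_intervalPairs_div h0 h.le h1).eventually_const_lt (sub_pos.mpr h)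
  filter_upwards [h2] with N hN
  rw [← card_pos]
  by_contra hcon
  have : #(intervalPairs ξ η N) = 0 := by omega
  rw [this] at hN
  simp at hN

/-- The point `(c / N, -x⁻¹ / c)` attached to a pair `(c, x)`. -/
noncomputable def scaledPoint (N : ℕ) (y : Σ _ : ℕ, ℕ) : ℝ × ℝ :=
  ((y.1 : ℝ) / N, (negInv y.1 y.2 : ℝ) / y.1)

/-- Clamping a real number to `[0, 1]`. -/
noncomputable def clampUnit (s : ℝ) : ℝ := max 0 (min s 1)

lemma div_le_iff_le_floor_clampUnit {N c : ℕ} (hc : 1 ≤ c) (hcN : c ≤ N) (s : ℝ) :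
    (c : ℝ) / N ≤ s ↔ c ≤ ⌊clampUnit s * N⌋₊ := by
  have hN : (0 : ℝ) < N := by exact_mod_cast (by omega : 0 < N)
  have hc' : (0 : ℝ) < c := by exact_mod_cast hc
  have h0 : 0 ≤ clampUnit s := le_max_left _ _
  rw [Nat.le_floor_iff (by positivity), div_le_iff₀ hN, clampUnit, max_mul_of_nonneg _ _ hN.le,
    min_mul_of_nonneg _ _ hN.le, zero_mul, one_mul, le_max_iff, le_min_iff]
  have : (c : ℝ) ≤ N := by exact_mod_cast hcN
  constructor
  · intro h; exact Or.inr ⟨h, this⟩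
  · rintro (h | h)
    · linarith
    · exact h.1

lemma floor_clampUnit_le (s : ℝ) (N : ℕ) : ⌊clampUnit s * N⌋₊ ≤ N := by
  have : clampUnit s ≤ 1 := max_le zero_le_one (min_le_right _ _)
  calc ⌊clampUnit s * N⌋₊ ≤ ⌊(N : ℝ)⌋₊ := by
        gcongr
        nlinarith [Nat.cast_nonneg (α := ℝ) N]
    _ = N := Nat.floor_natCast N

-- A condition on `c / N` is a condition on the level, so the count is a difference of two levels;
-- clamping covers endpoints outside `[0, 1]`.
open Classical in
lemma card_scaledPoint_box (ξ η : ℝ) {s₁ s₂ : ℝ} (hs : s₁ ≤ s₂) (a b : ℝ) (N : ℕ) :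
    (#{y ∈ intervalPairs ξ η N | scaledPoint N y ∈ Set.Ioc s₁ s₂ ×ˢ Set.Ioc a b} : ℝ) =
      (#{y ∈ coprimePairs ⌊clampUnit s₂ * N⌋₊ | pairPoint y ∈ Set.Ioc ξ η ×ˢ Set.Ioc a b} : ℝ) -
      #{y ∈ coprimePairs ⌊clampUnit s₁ * N⌋₊ | pairPoint y ∈ Set.Ioc ξ η ×ˢ Set.Ioc a b} := by
  rw [eq_sub_iff_add_eq]
  norm_cast
  rw [← card_union_of_disjoint]
  · congr 1
    ext y
    simp only [mem_union, mem_filter, intervalPairs, mem_coprimePairs, scaledPoint, pairPoint,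
      Set.mem_prod, Set.mem_Ioc]
    have key := fun (h1 : 1 ≤ y.1) (h2 : y.1 ≤ N) (s : ℝ) => div_le_iff_le_floor_clampUnit h1 h2 s
    have hle := floor_clampUnit_le s₁ N
    have hle2 := floor_clampUnit_le s₂ N
    have hmono : ⌊clampUnit s₁ * N⌋₊ ≤ ⌊clampUnit s₂ * N⌋₊ := by
      unfold clampUnit; gcongr
    constructor
    · rintro (⟨⟨⟨h1, h2, h3⟩, h4⟩, ⟨h5, h6⟩, h7⟩ | ⟨⟨h1, h2, h3⟩, h4⟩)
      · exact ⟨⟨h1, (key h1 h2 s₂).mp h6, h3⟩, h4, h7⟩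
      · exact ⟨⟨h1, h2.trans hmono, h3⟩, h4⟩
    · rintro ⟨⟨h1, h2, h3⟩, h4, h7⟩
      have h2' := h2.trans hle2
      by_cases h : (y.1 : ℝ) / N ≤ s₁
      · exact Or.inr ⟨⟨h1, (key h1 h2' s₁).mp h, h3⟩, h4, h7⟩
      · exact Or.inl ⟨⟨⟨h1, h2', h3⟩, h4⟩, ⟨not_le.mp h, (key h1 h2' s₂).mpr h2⟩, h7⟩
  · rw [Finset.disjoint_left]
    intro y hy hy'
    simp only [mem_filter, intervalPairs, mem_coprimePairs, scaledPoint,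
      Set.mem_prod, Set.mem_Ioc] at hy hy'
    obtain ⟨⟨⟨h1, h2, -⟩, -⟩, ⟨h5, -⟩, -⟩ := hy
    exact not_le.mpr h5 ((div_le_iff_le_floor_clampUnit h1 h2 s₁).mpr hy'.1.2.1)

lemma suspensionMeasure_real_box {s₁ s₂ : ℝ} (hs : s₁ ≤ s₂) (a b : ℝ) :
    suspensionMeasure.real (Set.Ioc s₁ s₂ ×ˢ Set.Ioc a b) =
      (clampUnit s₂ ^ 2 - clampUnit s₁ ^ 2) *
        (volume.restrict (Set.Ioc (0 : ℝ) 1)).real (Set.Ioc a b) := by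
  rw [suspensionMeasure, measureReal_prod_prod]
  congr 1
  have h0 : ∀ s, 0 ≤ clampUnit s := fun s => le_max_left _ _
  have h1 : ∀ s, clampUnit s ≤ 1 := fun s => max_le zero_le_one (min_le_right _ _)
  have hm : clampUnit s₁ ≤ clampUnit s₂ := by unfold clampUnit; gcongr
  have e : Set.Ioc s₁ s₂ ∩ Set.Ioc 0 1 = Set.Ioc (clampUnit s₁) (clampUnit s₂) := by
    ext s
    simp only [Set.mem_inter_iff, Set.mem_Ioc, clampUnit, max_lt_iff, min_lt_iff, le_max_iff,
      le_min_iff]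
    constructor
    · rintro ⟨⟨h1, h2⟩, h3, h4⟩; exact ⟨⟨h3, Or.inl h1⟩, Or.inr ⟨h2, h4⟩⟩
    · rintro ⟨⟨h3, h1⟩, h2⟩
      rcases h2 with h2 | ⟨h2, h4⟩
      · exact absurd h3 (not_lt.mpr h2)
      · rcases h1 with h1 | h1
        · exact ⟨⟨h1, h2⟩, h3, h4⟩
        · exact absurd h1 (not_lt.mpr h4)
  have e2 : ((volume.restrict (Set.Ioc (0 : ℝ) 1)).withDensity fun s => ENNReal.ofReal (2 * s))
      (Set.Ioc s₁ s₂) = ((volume.restrict (Set.Ioc (0 : ℝ) 1)).withDensity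
        fun s => ENNReal.ofReal (2 * s)) (Set.Ioc (clampUnit s₁) (clampUnit s₂)) := by
    rw [← e, withDensity_apply _ measurableSet_Ioc,
      withDensity_apply _ (measurableSet_Ioc.inter measurableSet_Ioc),
      Measure.restrict_restrict measurableSet_Ioc,
      Measure.restrict_restrict (measurableSet_Ioc.inter measurableSet_Ioc), Set.inter_assoc,
      Set.inter_self]
  rw [Measure.real, e2, withDensity_Ioc (h0 _) hm (h1 _), ENNReal.toReal_ofReal]
  nlinarith [h0 s₁, h0 s₂]

/-- Convergence is checked on boxes, a π-system containing small neighbourhoods of every point.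
There the limit factors, and the length of $(\xi, \eta]$ cancels: the position of the fraction is
asymptotically independent of the other two quantities. -/
lemma tendsto_empiricalMeasure_scaledPoint {ξ η : ℝ} (h0 : 0 ≤ ξ) (h : ξ < η) (h1 : η ≤ 1) :
    Tendsto (fun N : ℕ => bundleProb (empiricalMeasure (intervalPairs ξ η N) (scaledPoint N))) atTop
      (𝓝 (bundleProb suspensionMeasure)) := by
  classical
  have hpi := (isPiSystem_Ioc (id : ℝ → ℝ) (id : ℝ → ℝ)).prod
    (isPiSystem_Ioc (id : ℝ → ℝ) (id : ℝ → ℝ))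
  refine hpi.tendsto_probabilityMeasure_of_tendsto_of_mem ?_ ?_ ?_
  · rintro _ ⟨_, ⟨a, b, -, rfl⟩, _, ⟨c, d, -, rfl⟩, rfl⟩
    exact measurableSet_Ioc.prod measurableSet_Ioc
  · intro u hu x hx
    obtain ⟨ε, hε, hball⟩ := Metric.isOpen_iff.mp hu x hx
    refine ⟨Set.Ioc (x.1 - ε / 2) (x.1 + ε / 2) ×ˢ Set.Ioc (x.2 - ε / 2) (x.2 + ε / 2),
      ⟨_, ⟨_, _, by simp only [id]; linarith, rfl⟩, _, ⟨_, _, by simp only [id]; linarith, rfl⟩, rfl⟩,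
      ?_, ?_⟩
    · exact prod_mem_nhds (Ioc_mem_nhds (by linarith) (by linarith))
        (Ioc_mem_nhds (by linarith) (by linarith))
    · intro z hz
      apply hball
      obtain ⟨⟨h1, h2⟩, h3, h4⟩ := hz
      rw [Metric.mem_ball, Prod.dist_eq, max_lt_iff, Real.dist_eq, Real.dist_eq, abs_lt, abs_lt]
      refine ⟨⟨?_, ?_⟩, ?_, ?_⟩ <;> linarith
  · rintro _ ⟨_, ⟨s₁, s₂, hs, rfl⟩, _, ⟨a, b, -, rfl⟩, rfl⟩
    simp only [id] at hs ⊢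
    have hc : ∀ s, 0 ≤ clampUnit s := fun s => le_max_left _ _
    have t1 := ((tendsto_card_box_floor_div ξ η a b (hc s₂)).sub
      (tendsto_card_box_floor_div ξ η a b (hc s₁))).div
      (tendsto_card_intervalPairs_div h0 h.le h1) (sub_pos.mpr h).ne'
    have e : (squareMeasure.real (Set.Ioc ξ η ×ˢ Set.Ioc a b) * clampUnit s₂ ^ 2 -
        squareMeasure.real (Set.Ioc ξ η ×ˢ Set.Ioc a b) * clampUnit s₁ ^ 2) / (η - ξ) =
        suspensionMeasure.real (Set.Ioc s₁ s₂ ×ˢ Set.Ioc a b) := by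
      rw [squareMeasure_real_box h0 h.le h1, suspensionMeasure_real_box hs.le]
      have : η - ξ ≠ 0 := (sub_pos.mpr h).ne'
      field_simp
    rw [e] at t1
    rw [← NNReal.tendsto_coe]
    refine Tendsto.congr' ?_ t1
    filter_upwards [eventually_intervalPairs_nonempty h0 h h1, eventually_gt_atTop 0] with N hN hN0
    have := empiricalMeasure_real hN (scaledPoint N)
      ((measurableSet_Ioc (a := s₁) (b := s₂)).prod (measurableSet_Ioc (a := a) (b := b)))
    have ht : (totientSum N : ℝ) ≠ 0 := by exact_mod_cast (totientSum_pos hN0).ne'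
    change _ = (empiricalMeasure (intervalPairs ξ η N) (scaledPoint N)).real _
    rw [this, card_scaledPoint_box ξ η hs.le]
    simp only [Pi.div_apply]
    rw [← sub_div, div_div_div_cancel_right₀ ht]

/-- The points of the Farey triangle attached to the Farey fractions in `(ξ, η]` charge every open
set asymptotically at least as much as `fareyMeasure` does. -/
lemma fareyMeasure_le_liminf {ξ η : ℝ} (h0 : 0 ≤ ξ) (h : ξ < η) (h1 : η ≤ 1) {G : Set (ℝ × ℝ)}
    (hG : IsOpen G) :
    fareyMeasure G ≤ liminf (fun N : ℕ =>
      empiricalMeasure (intervalPairs ξ η N) (suspensionMap ∘ scaledPoint N) G) atTop := by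
  classical
  have hU := continuousOn_suspensionMap.isOpen_inter_preimage isOpen_suspensionRegular hG
  have h2 := ProbabilityMeasure.le_liminf_measure_open_of_tendsto
    (tendsto_empiricalMeasure_scaledPoint h0 h h1) hU
  simp only [coe_bundleProb] at h2
  calc fareyMeasure G = suspensionMeasure (suspensionMap ⁻¹' G) := by
        rw [← map_suspensionMap, Measure.map_apply measurable_suspensionMap hG.measurableSet]
    -- Discarding the null set of discontinuities makes the preimage open, so the open-set
    -- inequality applies to it.
    _ ≤ suspensionMeasure (suspensionRegular ∩ suspensionMap ⁻¹' G) := by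
        refine measure_mono_ae ?_
        have : ∀ᵐ x ∂suspensionMeasure, x ∈ suspensionRegular :=
          suspensionMeasure_compl_suspensionRegular
        filter_upwards [this] with x hx hxG
        exact ⟨hx, hxG⟩
    _ ≤ _ := h2
    _ ≤ _ := by
        refine liminf_le_liminf ?_
        filter_upwards [eventually_intervalPairs_nonempty h0 h h1] with N hN
        rw [empiricalMeasure_apply hN _ hU.measurableSet,
          empiricalMeasure_apply hN _ hG.measurableSet]
        gcongr ?_ / _
        norm_cast
        refine Finset.card_le_card fun y hy => ?_
        rw [mem_filter] at hy ⊢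
        exact ⟨hy.1, hy.2.2⟩

end Equidistribution

/-! ### Portmanteau inequalities on an open set. -/

section Portmanteau

/-- The portmanteau inequality for nonnegative functions that are continuous on an open set,
extended by zero. -/
lemma lintegral_indicator_le_liminf {X : Type*} [MeasurableSpace X] [TopologicalSpace X]
    [OpensMeasurableSpace X] {μ : Measure X} {μs : ℕ → Measure X}
    (h_opens : ∀ G, IsOpen G → μ G ≤ liminf (fun i => μs i G) atTop) {P : Set X} (hP : IsOpen P)
    {f : X → ℝ} (hf : ContinuousOn f P) (hnn : ∀ x ∈ P, 0 ≤ f x) :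
    ∫⁻ x, ENNReal.ofReal (P.indicator f x) ∂μ ≤
      liminf (fun i => ∫⁻ x, ENNReal.ofReal (P.indicator f x) ∂μs i) atTop := by
  classical
  have hmeas : Measurable (P.indicator f) := by
    rw [← Set.piecewise_eq_indicator]
    exact hf.measurable_piecewise continuousOn_const hP.measurableSet
  have hg : 0 ≤ P.indicator f := fun x => Set.indicator_nonneg hnn x
  have hopen : ∀ t ∈ Set.Ioi (0 : ℝ), IsOpen {x | t < P.indicator f x} := by
    intro t ht
    have : {x | t < P.indicator f x} = P ∩ f ⁻¹' Set.Ioi t := by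
      ext x
      by_cases hx : x ∈ P
      · simp [hx]
      · simpa [hx] using (Set.mem_Ioi.mp ht).le
    rw [this]
    exact hf.isOpen_inter_preimage hP isOpen_Ioi
  -- Layer cake: the superlevel sets at heights `t > 0` are open even though the indicator is
  -- discontinuous, and Fatou's lemma in `t` finishes.
  simp_rw [lintegral_eq_lintegral_meas_lt _ (Eventually.of_forall hg) hmeas.aemeasurable]
  calc ∫⁻ t in Set.Ioi (0 : ℝ), μ {x | t < P.indicator f x}
      ≤ ∫⁻ t in Set.Ioi (0 : ℝ), liminf (fun i => μs i {x | t < P.indicator f x}) atTop :=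
        setLIntegral_mono' measurableSet_Ioi fun t ht => h_opens _ (hopen t ht)
    _ ≤ _ := lintegral_liminf_le fun n => Antitone.measurable fun s t hst =>
        measure_mono fun x hx => lt_of_le_of_lt hst hx

lemma eventually_lt_integral_indicator {X : Type*} [MeasurableSpace X] [TopologicalSpace X]
    [OpensMeasurableSpace X] {μ : Measure X} {μs : ℕ → Measure X} [IsProbabilityMeasure μ]
    [∀ i, IsProbabilityMeasure (μs i)]
    (h_opens : ∀ G, IsOpen G → μ G ≤ liminf (fun i => μs i G) atTop) {P : Set X} (hP : IsOpen P)
    {f : X → ℝ} (hf : ContinuousOn f P) (hnn : ∀ x ∈ P, 0 ≤ f x) {C : ℝ}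
    (hC : ∀ x ∈ P, f x ≤ C) {r : ℝ} (hr : r < ∫ x, P.indicator f x ∂μ) :
    ∀ᶠ i in atTop, r < ∫ x, P.indicator f x ∂μs i := by
  classical
  have hmeas : Measurable (P.indicator f) := by
    rw [← Set.piecewise_eq_indicator]
    exact hf.measurable_piecewise continuousOn_const hP.measurableSet
  have hg : 0 ≤ P.indicator f := fun x => Set.indicator_nonneg hnn x
  have hint : ∀ (ν : Measure X) [IsProbabilityMeasure ν], Integrable (P.indicator f) ν := by
    intro ν _
    refine Integrable.of_bound hmeas.aestronglyMeasurable (max C 0) (Eventually.of_forall fun x => ?_)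
    rw [Real.norm_eq_abs, abs_of_nonneg (hg x)]
    by_cases hx : x ∈ P
    · simp [hx, hC x hx]
    · simp [hx]
  rcases lt_or_ge r 0 with hr0 | hr0
  · exact Eventually.of_forall fun i => hr0.trans_le (integral_nonneg hg)
  have h := lintegral_indicator_le_liminf h_opens hP hf hnn
  rw [← ofReal_integral_eq_lintegral_ofReal (hint μ) (Eventually.of_forall hg)] at h
  have h2 : ENNReal.ofReal r < ENNReal.ofReal (∫ x, P.indicator f x ∂μ) :=
    (ENNReal.ofReal_lt_ofReal_iff_of_nonneg hr0).mpr hr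
  filter_upwards [eventually_lt_of_lt_liminf (h2.trans_le h)] with i hi
  rw [← ofReal_integral_eq_lintegral_ofReal (hint _) (Eventually.of_forall hg),
    ENNReal.ofReal_lt_ofReal_iff_of_nonneg hr0] at hi
  exact hi

end Portmanteau

/-! ### Averages of piecewise continuous functions. -/

section Averages

open scoped Finset

/-- Continuity on open sets is local, so all the pieces merge into one open set of full measure. -/
lemma PiecewiseContinuousOn.exists_isOpen {f : ℝ × ℝ → ℝ}
    (hf : PiecewiseContinuousOn f fareyTriangle) :
    ∃ P : Set (ℝ × ℝ), IsOpen P ∧ P ⊆ fareyTriangle ∧ ContinuousOn f P ∧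
      fareyMeasure Pᶜ = 0 := by
  obtain ⟨Q, hQo, hQs, -, hQ0, hQc⟩ := hf
  refine ⟨⋃ i, Q i, isOpen_iUnion hQo, Set.iUnion_subset hQs, ?_, ?_⟩
  · intro x hx
    obtain ⟨i, hi⟩ := Set.mem_iUnion.mp hx
    exact ((hQc i).continuousAt ((hQo i).mem_nhds hi)).continuousWithinAt
  · rw [fareyMeasure, Measure.smul_apply, Measure.restrict_apply' measurableSet_fareyTriangle,
      Set.inter_comm, ← Set.sdiff_eq, hQ0, smul_zero]

lemma integrable_of_piecewiseContinuousOn {f : ℝ × ℝ → ℝ}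
    (hf : PiecewiseContinuousOn f fareyTriangle) {C : ℝ} (hC : ∀ x ∈ fareyTriangle, |f x| ≤ C) :
    Integrable f fareyMeasure := by
  obtain ⟨P, hPo, hPs, hPc, hP0⟩ := hf.exists_isOpen
  have hae : ∀ᵐ x ∂fareyMeasure, x ∈ P := hP0
  refine Integrable.of_bound ?_ C ?_
  · have h := hPc.aestronglyMeasurable (μ := fareyMeasure) hPo.measurableSet
    rwa [Measure.restrict_eq_self_of_ae_mem hae] at h
  · filter_upwards [hae] with x hx
    exact hC x (hPs hx)

lemma scaledPoint_mem_fareyTriangle {ξ η : ℝ} {N : ℕ} {y : Σ _ : ℕ, ℕ}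
    (hy : y ∈ intervalPairs ξ η N) : suspensionMap (scaledPoint N y) ∈ fareyTriangle := by
  obtain ⟨h1, h2, -⟩ := mem_coprimePairs.mp (Finset.mem_filter.mp hy).1
  have h1' : (0 : ℝ) < y.1 := by exact_mod_cast h1
  have h2' : (y.1 : ℝ) ≤ N := by exact_mod_cast h2
  have hN : (0 : ℝ) < N := h1'.trans_le h2'
  exact suspensionMap_mem_fareyTriangle (div_pos h1' hN) ((div_le_one hN).mpr h2')

/-- Since $f + C \ge 0$ on the triangle, cutting it off outside `P` only lowers the empirical
averages, while the integral is unchanged. So a sample point falling off `P` does no harm. -/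
lemma eventually_lt_average {f : ℝ × ℝ → ℝ} (hf : PiecewiseContinuousOn f fareyTriangle) {C : ℝ}
    (hC : ∀ x ∈ fareyTriangle, |f x| ≤ C) {ξ η : ℝ} (h0 : 0 ≤ ξ) (h : ξ < η) (h1 : η ≤ 1) {r : ℝ}
    (hr : r < ∫ x, f x ∂fareyMeasure) :
    ∀ᶠ N : ℕ in atTop, r < (#(intervalPairs ξ η N) : ℝ)⁻¹ *
      ∑ y ∈ intervalPairs ξ η N, f (suspensionMap (scaledPoint N y)) := by
  have hint := integrable_of_piecewiseContinuousOn hf hC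
  obtain ⟨P, hPo, hPs, hPc, hP0⟩ := hf.exists_isOpen
  have hae : ∀ᵐ x ∂fareyMeasure, x ∈ P := hP0
  have hint2 : ∫ x, P.indicator (fun x => f x + C) x ∂fareyMeasure =
      (∫ x, f x ∂fareyMeasure) + C := by
    have : ∫ x, P.indicator (fun x => f x + C) x ∂fareyMeasure = ∫ x, (f x + C) ∂fareyMeasure := by
      refine integral_congr_ae ?_
      filter_upwards [hae] with x hx
      simp [hx]
    rw [this, integral_add hint (integrable_const C)]
    simp
  have hev := eventually_lt_integral_indicator (μ := fareyMeasure)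
    (fun G hG => fareyMeasure_le_liminf h0 h h1 hG) hPo
    (f := fun x => f x + C) (hPc.add continuousOn_const)
    (fun x hx => by linarith [(abs_le.mp (hC x (hPs hx))).1])
    (C := C + C) (fun x hx => by linarith [(abs_le.mp (hC x (hPs hx))).2])
    (r := r + C) (by rw [hint2]; linarith)
  filter_upwards [hev, eventually_intervalPairs_nonempty h0 h h1] with N hN hne
  rw [integral_empiricalMeasure hne] at hN
  have hcard : (0 : ℝ) < #(intervalPairs ξ η N) := by exact_mod_cast Finset.card_pos.mpr hne
  have hle : ∑ y ∈ intervalPairs ξ η N,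
      P.indicator (fun x => f x + C) ((suspensionMap ∘ scaledPoint N) y) ≤
      ∑ y ∈ intervalPairs ξ η N, (f (suspensionMap (scaledPoint N y)) + C) := by
    refine Finset.sum_le_sum fun y hy => ?_
    refine Set.indicator_apply_le' (fun _ => le_rfl) (fun _ => ?_)
    have := hC _ (scaledPoint_mem_fareyTriangle hy)
    linarith [(abs_le.mp this).1]
  rw [Finset.sum_add_distrib, Finset.sum_const, nsmul_eq_mul] at hle
  rw [smul_eq_mul] at hN
  have h3 := hN.trans_le (mul_le_mul_of_nonneg_left hle (inv_nonneg.mpr hcard.le))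
  rw [mul_add, inv_mul_cancel_left₀ hcard.ne'] at h3
  linarith

lemma PiecewiseContinuousOn.neg {f : ℝ × ℝ → ℝ} {S : Set (ℝ × ℝ)}
    (hf : PiecewiseContinuousOn f S) : PiecewiseContinuousOn (fun x => -f x) S := by
  obtain ⟨Q, hQo, hQs, hQd, hQ0, hQc⟩ := hf
  exact ⟨Q, hQo, hQs, hQd, hQ0, fun i => (hQc i).neg⟩

/-- The averages of `f` over the points attached to the Farey fractions in `(ξ, η]` converge to
the integral of `f`. -/
lemma tendsto_average {f : ℝ × ℝ → ℝ} (hf : PiecewiseContinuousOn f fareyTriangle) {C : ℝ}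
    (hC : ∀ x ∈ fareyTriangle, |f x| ≤ C) {ξ η : ℝ} (h0 : 0 ≤ ξ) (h : ξ < η) (h1 : η ≤ 1) :
    Tendsto (fun N : ℕ => (#(intervalPairs ξ η N) : ℝ)⁻¹ *
      ∑ y ∈ intervalPairs ξ η N, f (suspensionMap (scaledPoint N y))) atTop
      (𝓝 (∫ x, f x ∂fareyMeasure)) := by
  refine tendsto_order.mpr ⟨fun r hr => eventually_lt_average hf hC h0 h h1 hr, fun r hr => ?_⟩
  have h2 := eventually_lt_average hf.neg (C := C) (fun x hx => by rw [abs_neg]; exact hC x hx)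
    h0 h h1 (r := -r) (by rw [integral_neg]; linarith)
  filter_upwards [h2] with N hN
  rw [Finset.sum_neg_distrib, mul_neg] at hN
  linarith

/-- The sums of `f` over the points attached to the Farey fractions in `(ξ, η]`. -/
lemma tendsto_sum_div_totientSum {f : ℝ × ℝ → ℝ} (hf : PiecewiseContinuousOn f fareyTriangle)
    {C : ℝ} (hC : ∀ x ∈ fareyTriangle, |f x| ≤ C) {ξ η : ℝ} (h0 : 0 ≤ ξ) (h : ξ < η)
    (h1 : η ≤ 1) :
    Tendsto (fun N : ℕ => (∑ y ∈ intervalPairs ξ η N, f (suspensionMap (scaledPoint N y))) /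
      totientSum N) atTop (𝓝 ((η - ξ) * ∫ x, f x ∂fareyMeasure)) := by
  refine ((tendsto_card_intervalPairs_div h0 h.le h1).mul
    (tendsto_average hf hC h0 h h1)).congr' ?_
  filter_upwards [eventually_intervalPairs_nonempty h0 h h1] with N hN
  have : (#(intervalPairs ξ η N) : ℝ) ≠ 0 := by exact_mod_cast (Finset.card_pos.mpr hN).ne'
  field_simp

end Averages

/-! ### The index of the last Farey fraction. -/

section FareyIndex

open Finset

/-- Lowest terms match the nonzero Farey fractions with `coprimePairs n`; the fraction 0 is the one
removed by the `- 1`. -/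
lemma fareyIndex_eq_totientSum {n : ℕ} (hn : 0 < n) : fareyIndex n = totientSum n := by
  have hinj : Set.InjOn (fun y : Σ _ : ℕ, ℕ => (y.2 : ℚ) / y.1) (coprimePairs n : Set _) := by
    rintro ⟨c, x⟩ hy ⟨c', x'⟩ hy' h
    obtain ⟨h1, -, -, -, h5⟩ := mem_coprimePairs.mp (mem_coe.mp hy)
    obtain ⟨h1', -, -, -, h5'⟩ := mem_coprimePairs.mp (mem_coe.mp hy')
    simp only at h h1 h1' h5 h5'
    have e := Rat.num_div_eq_of_coprime (a := x) (b := c) (by exact_mod_cast h1) (by simpa using h5)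
    have e' := Rat.num_div_eq_of_coprime (a := x') (b := c') (by exact_mod_cast h1')
      (by simpa using h5')
    have d := Rat.den_div_eq_of_coprime (a := x) (b := c) (by exact_mod_cast h1) (by simpa using h5)
    have d' := Rat.den_div_eq_of_coprime (a := x') (b := c') (by exact_mod_cast h1')
      (by simpa using h5')
    push_cast at e e' d d'
    rw [h] at e d
    have hx : (x : ℤ) = x' := e.symm.trans e'
    have hc : (c : ℤ) = c' := d.symm.trans d'
    have hx' : x = x' := by exact_mod_cast hx
    have hc' : c = c' := by exact_mod_cast hc
    rw [hx', hc']
  have hset : fareySet n =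
      insert 0 ((fun y : Σ _ : ℕ, ℕ => (y.2 : ℚ) / y.1) '' (coprimePairs n : Set _)) := by
    ext r
    simp only [fareySet, Set.mem_ofPred_eq, Set.mem_insert_iff, Set.mem_image, mem_coe,
      mem_coprimePairs]
    constructor
    · rintro ⟨h0, h1, h2⟩
      rcases h0.eq_or_lt with h0 | h0
      · exact Or.inl h0.symm
      · right
        have hnum : 0 < r.num := Rat.num_pos.mpr h0
        have e : ((r.num.toNat : ℕ) : ℤ) = r.num := Int.toNat_of_nonneg hnum.le
        have e2 : ((r.num.toNat : ℕ) : ℚ) = r.num := by exact_mod_cast e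
        refine ⟨⟨r.den, r.num.toNat⟩, ⟨r.pos, h2, by simp only; omega, ?_, ?_⟩, ?_⟩
        · have : r.num ≤ r.den := by
            have h3 := Rat.num_div_den r
            have hd : (0 : ℚ) < r.den := by exact_mod_cast r.pos
            rw [← h3, div_le_one hd] at h1
            exact_mod_cast h1
          simp only; omega
        · have := r.reduced
          rwa [← e, Int.natAbs_natCast] at this
        · simp only
          rw [e2]; exact Rat.num_div_den r
    · rintro (rfl | ⟨⟨c, x⟩, ⟨h1, h2, h3, h4, h5⟩, rfl⟩)
      · exact ⟨le_rfl, zero_le_one, by simpa using Nat.succ_le_of_lt hn⟩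
      · simp only at h1 h2 h3 h4 h5 ⊢
        have d := Rat.den_div_eq_of_coprime (a := x) (b := c) (by exact_mod_cast h1)
          (by simpa using h5)
        push_cast at d
        have hc : (0 : ℚ) < c := by exact_mod_cast h1
        refine ⟨by positivity, (div_le_one hc).mpr (by exact_mod_cast h4), ?_⟩
        have : ((x : ℚ) / c).den = c := by exact_mod_cast d
        rw [this]; exact h2
  have h0 : (0 : ℚ) ∉ (fun y : Σ _ : ℕ, ℕ => (y.2 : ℚ) / y.1) '' (coprimePairs n : Set _) := by
    rintro ⟨y, hy, h⟩
    obtain ⟨h1, -, h3, -⟩ := mem_coprimePairs.mp (mem_coe.mp hy)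
    have h1' : (0 : ℚ) < y.1 := by exact_mod_cast h1
    have h3' : (0 : ℚ) < y.2 := by exact_mod_cast h3
    exact (div_pos h3' h1').ne' h
  rw [fareyIndex, hset, Set.ncard_insert_of_notMem h0 ((coprimePairs n).finite_toSet.image _),
    hinj.ncard_image, Set.ncard_coe_finset, card_coprimePairs, Nat.add_sub_cancel]

end FareyIndex

/-! ### BCZ orbits as unimodular chains, and uniqueness of excursions. -/

section Orbits

lemma bczMap_mem {x : ℝ × ℝ} (hx : x ∈ fareyTriangle) : bczMap x ∈ fareyTriangle := by
  obtain ⟨h1, h2, h3, h4, h5⟩ := hx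
  have k1 := Int.floor_le ((1 + x.1) / x.2)
  have k2 := Int.lt_floor_add_one ((1 + x.1) / x.2)
  rw [le_div_iff₀ h3] at k1
  rw [div_lt_iff₀ h3] at k2
  refine ⟨h3, h4, ?_, ?_, ?_⟩
  · change 0 < (⌊(1 + x.1) / x.2⌋ : ℝ) * x.2 - x.1; linarith
  · change (⌊(1 + x.1) / x.2⌋ : ℝ) * x.2 - x.1 ≤ 1; linarith
  · change 1 < x.2 + ((⌊(1 + x.1) / x.2⌋ : ℝ) * x.2 - x.1); linarith

lemma iterate_bczMap_mem {x : ℝ × ℝ} (hx : x ∈ fareyTriangle) (i : ℕ) :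
    bczMap^[i] x ∈ fareyTriangle := by
  induction i with
  | zero => exact hx
  | succ i ih => rw [Function.iterate_succ_apply']; exact bczMap_mem ih

lemma iterate_bczMap_snd (x : ℝ × ℝ) (i : ℕ) : (bczMap^[i] x).2 = (bczMap^[i + 1] x).1 := by
  rw [Function.iterate_succ_apply']; rfl

/-- The coordinates of the orbit points are unimodular integer combinations of the coordinates of
the starting point. -/
lemma exists_coords (x : ℝ × ℝ) : ∃ α β : ℕ → ℤ, α 0 = 1 ∧ β 0 = 0 ∧ α 1 = 0 ∧ β 1 = 1 ∧
    (∀ i, (bczMap^[i] x).1 = α i * x.1 + β i * x.2) ∧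
    ∀ i, α i * β (i + 1) - α (i + 1) * β i = 1 := by
  -- `V i` holds the coefficient vectors of both coordinates of the `i`-th point, because the
  -- recursion has order two.
  let k : ℕ → ℤ := fun i => ⌊(1 + (bczMap^[i] x).1) / (bczMap^[i] x).2⌋
  let V : ℕ → (ℤ × ℤ) × (ℤ × ℤ) := fun i => Nat.rec ((1, 0), (0, 1))
    (fun i v => (v.2, (k i * v.2.1 - v.1.1, k i * v.2.2 - v.1.2))) i
  have hV : ∀ i, V (i + 1) = ((V i).2, (k i * (V i).2.1 - (V i).1.1, k i * (V i).2.2 - (V i).1.2)) :=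
    fun i => rfl
  have hpt : ∀ i, bczMap^[i] x = (((V i).1.1 : ℝ) * x.1 + (V i).1.2 * x.2,
      ((V i).2.1 : ℝ) * x.1 + (V i).2.2 * x.2) := by
    intro i
    induction i with
    | zero => simp [V]
    | succ i ih =>
      have h1 : bczMap^[i + 1] x = ((bczMap^[i] x).2,
          (k i : ℝ) * (bczMap^[i] x).2 - (bczMap^[i] x).1) := by
        rw [Function.iterate_succ_apply']; rfl
      rw [h1, hV, ih]
      simp only [Prod.mk.injEq, true_and]
      push_cast
      ring
  have hdet : ∀ i, (V i).1.1 * (V i).2.2 - (V i).2.1 * (V i).1.2 = 1 := by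
    intro i
    induction i with
    | zero => simp [V]
    | succ i ih => rw [hV]; simp only; linear_combination ih
  refine ⟨fun i => (V i).1.1, fun i => (V i).1.2, rfl, rfl, rfl, rfl, fun i => by rw [hpt i],
    fun i => ?_⟩
  simp only [hV]
  exact hdet i

/-- Along a unimodular chain of vectors, two vectors such that all vectors strictly between them
have larger value under a linear form that is positive on the chain span the lattice. -/
lemma det_eq_one_of_lt {a : ℕ → ℝ} {α β : ℕ → ℤ} {A B : ℝ}
    (ha : ∀ i, a i = α i * A + β i * B) (hpos : ∀ i, 0 < a i)
    (hdet : ∀ i, α i * β (i + 1) - α (i + 1) * β i = 1) (d : ℕ) :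
    ∀ i j, i < j → j - i ≤ d → (∀ m, i < m → m < j → a i < a m ∧ a j ≤ a m) →
      α i * β j - α j * β i = 1 := by
  induction d with
  | zero => intro i j hij hd; omega
  | succ d ih =>
    intro i j hij hd h
    rcases (Nat.succ_le_of_lt hij).eq_or_lt with e | hlt
    · rw [← e]; exact hdet i
    -- Split at the last minimum `m` strictly between `i` and `j`. Taking the last one gives
    -- strictness to the right of `m`, so both halves satisfy the hypothesis, strict at the left end
    -- and weak at the right.
    · obtain ⟨m₀, hm₀, hmin⟩ := Finset.exists_min_image (Finset.Ioo i j) a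
        ⟨i + 1, by simp; omega⟩
      obtain ⟨m, hm, hmax⟩ := Finset.exists_max_image
        ((Finset.Ioo i j).filter fun k => a k = a m₀) id ⟨m₀, by simp [Finset.mem_Ioo.mp hm₀]⟩
      rw [Finset.mem_filter, Finset.mem_Ioo] at hm
      obtain ⟨⟨him, hmj⟩, ham⟩ := hm
      have hmin' : ∀ k, i < k → k < j → a m ≤ a k := fun k h1 h2 => by
        rw [ham]; exact hmin k (Finset.mem_Ioo.mpr ⟨h1, h2⟩)
      have hlast : ∀ k, m < k → k < j → a m < a k := fun k h1 h2 => by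
        refine lt_of_le_of_ne (hmin' k (him.trans h1) h2) fun heq => ?_
        have := hmax k (by simp [heq ▸ ham]; omega)
        simp only [id] at this
        omega
      have d1 := ih i m him (by omega) fun k h1 h2 =>
        ⟨(h k h1 (h2.trans hmj)).1, hmin' k h1 (h2.trans hmj)⟩
      have d2 := ih m j hmj (by omega) fun k h1 h2 =>
        ⟨hlast k h1 h2, (h k (him.trans h1) h2).2⟩
      obtain ⟨b1, b2⟩ := h m him hmj
      -- As `0 < a i + a j < 2 * a m`, the integer determinant lies strictly between 0 and 2.
      have id1 : ((α i * β j - α j * β i : ℤ) : ℝ) * a m = a i + a j := by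
        have d1' : (α i * β m - α m * β i : ℝ) = 1 := by exact_mod_cast d1
        have d2' : (α m * β j - α j * β m : ℝ) = 1 := by exact_mod_cast d2
        rw [ha, ha, ha]
        push_cast
        linear_combination (α j * A + β j * B : ℝ) * d1' + (α i * A + β i * B : ℝ) * d2'
      set D := α i * β j - α j * β i with hD
      have hm0 := hpos m
      have hDpos : 0 < D := by
        by_contra hcon
        have : (D : ℝ) ≤ 0 := by exact_mod_cast not_lt.mp hcon
        nlinarith [hpos i, hpos j]
      have hDlt : D < 2 := by
        by_contra hcon
        have : (2 : ℝ) ≤ D := by exact_mod_cast not_lt.mp hcon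
        nlinarith
      omega

lemma Excursion.lt_of_lt (e : Excursion) {m : ℕ} (h0 : 0 < m) (hm : m < e.len) :
    e.start.1 < (bczMap^[m] e.start).1 ∧ (bczMap^[e.len] e.start).1 < (bczMap^[m] e.start).1 := by
  have hp := (iterate_bczMap_mem e.start_mem m).1
  obtain ⟨h1, h2⟩ := e.deeper m h0 hm
  exact ⟨(one_div_lt_one_div hp e.start_mem.1).mp h1,
    (one_div_lt_one_div hp (iterate_bczMap_mem e.start_mem e.len).1).mp h2⟩

/-- The starting vector is $(1, 0)$, so determinant 1 means that the last vector has second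
coefficient 1. -/
lemma Excursion.exists_snd_eq (e : Excursion) :
    ∃ k : ℤ, e.start.2 = (e.point e.len).1 + k * e.start.1 := by
  obtain ⟨α, β, h0, h1, h2, h3, h4, h5⟩ := exists_coords e.start
  have hdet := det_eq_one_of_lt h4 (fun i => (iterate_bczMap_mem e.start_mem i).1) h5 e.len 0 e.len
    e.len_pos (by omega) (fun m hm0 hm => by
      have := e.lt_of_lt hm0 hm
      exact ⟨this.1, this.2.le⟩)
  rw [h0, h1] at hdet
  have hβ : β e.len = 1 := by linarith
  refine ⟨-α e.len, ?_⟩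
  rw [Excursion.point, h4, hβ]
  push_cast; ring

/-- The second starting coordinate lies in $(1-a, 1]$ and is known modulo $a$, so the starting
points agree. If one excursion were shorter, its endpoint would be strictly inside the other and
give $b < b$. -/
lemma Excursion.eq_of_corresponds {e e' : Excursion} {a b : ℝ} (h : e.Corresponds a b)
    (h' : e'.Corresponds a b) : e = e' := by
  have h1 : e.start.1 = a := h.1
  have h1' : e'.start.1 = a := h'.1
  have h2 : (e.point e.len).1 = b := h.2
  have h2' : (e'.point e'.len).1 = b := h'.2
  have hstart : e.start = e'.start := by
    obtain ⟨k, hk⟩ := e.exists_snd_eq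
    obtain ⟨k', hk'⟩ := e'.exists_snd_eq
    rw [h1, h2] at hk
    rw [h1', h2'] at hk'
    obtain ⟨g1, -, -, g4, g5⟩ := e.start_mem
    obtain ⟨-, -, -, g4', g5'⟩ := e'.start_mem
    rw [h1] at g1
    rw [h1] at g5
    rw [h1'] at g5'
    have hkk : k = k' := by
      have l1 : ((k - k' : ℤ) : ℝ) < 1 := by
        push_cast
        by_contra hcon
        nlinarith [mul_le_mul_of_nonneg_right (not_lt.mp hcon) g1.le]
      have l2 : (-1 : ℝ) < ((k - k' : ℤ) : ℝ) := by
        push_cast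
        by_contra hcon
        nlinarith [mul_le_mul_of_nonneg_right (not_lt.mp hcon) g1.le]
      have l1' : k - k' < 1 := by exact_mod_cast l1
      have l2' : -1 < k - k' := by exact_mod_cast l2
      omega
    refine Prod.ext (h1.trans h1'.symm) ?_
    rw [hk, hk', hkk]
  have hlen : e.len = e'.len := by
    rcases lt_trichotomy e.len e'.len with hl | hl | hl
    · have := (e'.lt_of_lt e.len_pos hl).2
      rw [← hstart] at this
      change (e.point e'.len).1 < (e.point e.len).1 at this
      have e2 : (e.point e'.len).1 = b := by rw [← h2', Excursion.point, Excursion.point, hstart]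
      rw [h2, e2] at this
      exact absurd this (lt_irrefl _)
    · exact hl
    · have := (e.lt_of_lt e'.len_pos hl).2
      change (e.point e.len).1 < (e.point e'.len).1 at this
      have e2 : (e.point e'.len).1 = b := by rw [← h2', Excursion.point, Excursion.point, hstart]
      rw [h2, e2] at this
      exact absurd this (lt_irrefl _)
  exact Excursion.ext hstart hlen

end Orbits

/-! ### Excursions as stretches of the Farey sequence. -/

section ExcursionSums

/-- The determinant gives $c' \equiv -x^{-1} \pmod c$, and $n - c < c' \le n$ singles out one
element of this class. -/
lemma suspensionMap_eq_of_neighbor {n c x : ℕ} {c' x' : ℤ} (hc : 1 ≤ c) (hcn : c ≤ n)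
    (hc'n : c' ≤ n) (hcc' : (n : ℤ) < c + c') (hdet : x' * c - x * c' = 1) :
    suspensionMap (scaledPoint n ⟨c, x⟩) = ((c : ℝ) / n, (c' : ℝ) / n) := by
  have hc0 : (0 : ℝ) < c := by exact_mod_cast hc
  have hn : (0 : ℝ) < n := by exact_mod_cast hc.trans hcn
  have hs : (0 : ℝ) < (c : ℝ) / n := div_pos hc0 hn
  have hmod : (x : ZMod c) * (c' : ZMod c) = -1 := by
    have := congrArg (Int.cast : ℤ → ZMod c) hdet
    push_cast at this
    rw [ZMod.natCast_self] at this
    linear_combination -this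
  have hcop : Nat.Coprime x c := by
    rw [← Nat.isCoprime_iff_coprime]
    exact ⟨-c', x', by linear_combination hdet⟩
  have hinv : (x : ZMod c) * (x : ZMod c)⁻¹ = 1 := ZMod.coe_mul_inv_eq_one x hcop
  have hcast : ((c' - negInv c x : ℤ) : ZMod c) = 0 := by
    push_cast
    rw [natCast_negInv hc]
    linear_combination (x : ZMod c)⁻¹ * hmod - ((c' : ZMod c)) * hinv
  obtain ⟨z, hz⟩ := (ZMod.intCast_zmod_eq_zero_iff_dvd _ c).mp hcast
  have hz' : (c' : ℝ) - negInv c x = c * z := by exact_mod_cast hz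
  refine Prod.ext rfl ?_
  change (c : ℝ) / n * ((negInv c x : ℝ) / c + (⌊1 / ((c : ℝ) / n) - (negInv c x : ℝ) / c⌋ : ℝ)) =
    (c' : ℝ) / n
  rw [suspensionMap_snd_eq_toIocMod hs, toIocMod_eq_iff]
  refine ⟨⟨?_, ?_⟩, -z, ?_⟩
  · have : (n : ℝ) < c + c' := by exact_mod_cast hcc'
    rw [sub_lt_iff_lt_add, ← add_div, lt_div_iff₀ hn]
    linarith
  · have : (c' : ℝ) ≤ n := by exact_mod_cast hc'n
    rw [sub_add_cancel, div_le_one hn]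
    exact this
  · rw [zsmul_eq_mul]
    push_cast
    field_simp
    linear_combination -hz'

/-- A Farey chain: `N i / A i`, `0 ≤ i ≤ s`, are the consecutive Farey fractions of order `n`
between `x / q` and `y / p`. -/
structure IsFareyChain (n p q x y s : ℕ) (A N : ℕ → ℤ) : Prop where
  start_den : A 0 = q
  start_num : N 0 = x
  last_den : A s = p
  last_num : N s = y
  pos : ∀ i, 1 ≤ A i
  le : ∀ i, A i ≤ n
  lt_add : ∀ i, (n : ℤ) < A i + A (i + 1)
  det : ∀ i, N (i + 1) * A i - N i * A (i + 1) = 1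

namespace IsFareyChain

variable {n p q x y s : ℕ} {A N : ℕ → ℤ}

lemma strictMono (h : IsFareyChain n p q x y s A N) :
    StrictMono fun i => (N i : ℚ) / A i := by
  refine strictMono_nat_of_lt_succ fun i => ?_
  have h1 : (0 : ℚ) < A i := by exact_mod_cast h.pos i
  have h2 : (0 : ℚ) < A (i + 1) := by exact_mod_cast h.pos (i + 1)
  rw [div_lt_div_iff₀ h1 h2]
  have := h.det i
  have h3 : N i * A (i + 1) < N (i + 1) * A i := by linarith
  exact_mod_cast h3

lemma isCoprime (h : IsFareyChain n p q x y s A N) (i : ℕ) : IsCoprime (N i) (A i) :=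
  ⟨-A (i + 1), N (i + 1), by linear_combination h.det i⟩

/-- The chain misses no fraction: one strictly between two neighbours has denominator at least the
sum of theirs, which exceeds `n`. -/
lemma exists_eq (h : IsFareyChain n p q x y s A N) {c z : ℕ} (hc : 1 ≤ c) (hcn : c ≤ n)
    (hcop : z.Coprime c) (hlt : x * c < z * q) (hle : z * p ≤ y * c) :
    ∃ i, 1 ≤ i ∧ i ≤ s ∧ A i = c ∧ N i = z := by
  have hex : ∃ i, (z : ℤ) * A i ≤ N i * c := ⟨s, by
    rw [h.last_den, h.last_num]; exact_mod_cast hle⟩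
  classical
  set j := Nat.find hex with hj
  have hjs : j ≤ s := Nat.find_min' hex (by rw [h.last_den, h.last_num]; exact_mod_cast hle)
  have hspec : (z : ℤ) * A j ≤ N j * c := Nat.find_spec hex
  have hj0 : j ≠ 0 := by
    intro e
    rw [e, h.start_den, h.start_num] at hspec
    have : z * q ≤ x * c := by exact_mod_cast hspec
    omega
  obtain ⟨i, hi⟩ := Nat.exists_eq_succ_of_ne_zero hj0
  have hmin : N i * c < (z : ℤ) * A i := not_le.mp (Nat.find_min hex (by omega))
  rw [hi] at hspec
  have heq : (z : ℤ) * A (i + 1) = N (i + 1) * c := by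
    rcases hspec.eq_or_lt with e | hlt'
    · exact e
    · exfalso
      have e : (c : ℤ) = (N (i + 1) * c - z * A (i + 1)) * A i +
          (z * A i - N i * c) * A (i + 1) := by linear_combination -(c : ℤ) * h.det i
      have h1 : 1 ≤ N (i + 1) * c - z * A (i + 1) := by
        simp only [Nat.succ_eq_add_one] at hlt'; linarith [Int.add_one_le_of_lt hlt']
      have h2 : 1 ≤ (z : ℤ) * A i - N i * c := by linarith [Int.add_one_le_of_lt hmin]
      have h3 := h.lt_add i
      have h4 : (c : ℤ) ≤ n := by exact_mod_cast hcn
      nlinarith [h.pos i, h.pos (i + 1)]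
  have hcop' : IsCoprime (z : ℤ) c := Nat.isCoprime_iff_coprime.mpr hcop
  have hcop2 := h.isCoprime (i + 1)
  have d1 : (c : ℤ) ∣ A (i + 1) := hcop'.symm.dvd_of_dvd_mul_left ⟨N (i + 1), by
    rw [heq]; ring⟩
  have d2 : A (i + 1) ∣ c := hcop2.symm.dvd_of_dvd_mul_left ⟨z, by rw [← heq]; ring⟩
  have eA : A (i + 1) = c :=
    Int.dvd_antisymm (by linarith [h.pos (i + 1)]) (by positivity) d2 d1
  refine ⟨i + 1, by omega, by omega, eA, ?_⟩
  rw [eA] at heq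
  have hc0 : (c : ℤ) ≠ 0 := by exact_mod_cast (by omega : c ≠ 0)
  exact (mul_right_cancel₀ hc0 heq).symm

/-- Summation over a Farey chain. -/
lemma sum_eq (h : IsFareyChain n p q x y s A N) (hp : 0 < p) (hq : 0 < q)
    (hyp : y ≤ p) (F : ℝ × ℝ → ℝ) :
    ∑ i ∈ Finset.Icc 1 s, F ((A i : ℝ) / n, (A (i + 1) : ℝ) / n) =
      ∑ z ∈ intervalPairs ((x : ℝ) / q) ((y : ℝ) / p) n, F (suspensionMap (scaledPoint n z)) := by
  have hqQ : (0 : ℚ) < q := by exact_mod_cast hq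
  have hpQ : (0 : ℚ) < p := by exact_mod_cast hp
  have hqR : (0 : ℝ) < q := by exact_mod_cast hq
  have hpR : (0 : ℝ) < p := by exact_mod_cast hp
  have hAQ : ∀ i, (0 : ℚ) < A i := fun i => by exact_mod_cast h.pos i
  have hlow : ∀ i, 1 ≤ i → (x : ℤ) * A i < N i * q := by
    intro i hi
    have := h.strictMono (show 0 < i by omega)
    simp only [h.start_den, h.start_num, Int.cast_natCast] at this
    rw [div_lt_div_iff₀ hqQ (hAQ i)] at this
    exact_mod_cast this
  have hup : ∀ i, i ≤ s → N i * (p : ℤ) ≤ y * A i := by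
    intro i hi
    have := h.strictMono.monotone hi
    simp only [h.last_den, h.last_num, Int.cast_natCast] at this
    rw [div_le_div_iff₀ (hAQ i) hpQ] at this
    exact_mod_cast this
  have hN1 : ∀ i, 1 ≤ i → 1 ≤ N i := by
    intro i hi
    have h1 := hlow i hi
    have h2 : 0 ≤ (x : ℤ) * A i := mul_nonneg (by positivity) (by linarith [h.pos i])
    have h3 : 0 < N i * (q : ℤ) := by linarith
    have := pos_of_mul_pos_left h3 (by positivity)
    linarith
  have hNA : ∀ i, i ≤ s → N i ≤ A i := by
    intro i hi
    have h1 := hup i hi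
    have h2 : (y : ℤ) * A i ≤ p * A i :=
      mul_le_mul_of_nonneg_right (by exact_mod_cast hyp) (by linarith [h.pos i])
    have h3 : N i * (p : ℤ) ≤ A i * p := by linarith
    exact le_of_mul_le_mul_right h3 (by exact_mod_cast hp)
  refine Finset.sum_bij (fun i _ => ⟨(A i).toNat, (N i).toNat⟩) ?_ ?_ ?_ ?_
  · intro i hi
    rw [Finset.mem_Icc] at hi
    have a1 := h.pos i
    have a2 := h.le i
    have a3 := hN1 i hi.1
    have a4 := hNA i hi.2
    have eA : (((A i).toNat : ℕ) : ℤ) = A i := Int.toNat_of_nonneg (by linarith)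
    have eN : (((N i).toNat : ℕ) : ℤ) = N i := Int.toNat_of_nonneg (by linarith)
    have eA' : (((A i).toNat : ℕ) : ℝ) = A i := by exact_mod_cast eA
    have eN' : (((N i).toNat : ℕ) : ℝ) = N i := by exact_mod_cast eN
    have hAR : (0 : ℝ) < A i := by exact_mod_cast a1
    rw [intervalPairs, Finset.mem_filter, mem_coprimePairs]
    refine ⟨⟨by simp only; omega, by simp only; omega, by simp only; omega,
      by simp only; omega, ?_⟩, ?_, ?_⟩
    · rw [← Nat.isCoprime_iff_coprime, eA, eN]; exact h.isCoprime i
    · simp only [eA', eN']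
      rw [div_lt_div_iff₀ hqR hAR]
      exact_mod_cast hlow i hi.1
    · simp only [eA', eN']
      rw [div_le_div_iff₀ hAR hpR]
      exact_mod_cast hup i hi.2
  · intro i hi j hj hij
    rw [Finset.mem_Icc] at hi hj
    simp only [Sigma.mk.injEq, heq_eq_eq] at hij
    have a1 := h.pos i
    have b1 := h.pos j
    have a3 := hN1 i hi.1
    have b3 := hN1 j hj.1
    apply h.strictMono.injective
    have eA : A i = A j := by omega
    have eN : N i = N j := by omega
    simp only [eA, eN]
  · rintro ⟨c, z⟩ hz
    rw [intervalPairs, Finset.mem_filter, mem_coprimePairs] at hz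
    obtain ⟨⟨h1, h2, h3, h4, h5⟩, h6, h7⟩ := hz
    simp only at h1 h2 h3 h4 h5 h6 h7
    have hcR : (0 : ℝ) < c := by exact_mod_cast h1
    rw [div_lt_div_iff₀ hqR hcR] at h6
    rw [div_le_div_iff₀ hcR hpR] at h7
    obtain ⟨i, hi1, his, hA, hN⟩ := h.exists_eq h1 h2 h5 (by exact_mod_cast h6)
      (by exact_mod_cast h7)
    exact ⟨i, Finset.mem_Icc.mpr ⟨hi1, his⟩, by simp [hA, hN]⟩
  · intro i hi
    rw [Finset.mem_Icc] at hi
    have a1 := h.pos i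
    have a2 := h.le i
    have a3 := hN1 i hi.1
    have eA : (((A i).toNat : ℕ) : ℤ) = A i := Int.toNat_of_nonneg (by linarith)
    have eN : (((N i).toNat : ℕ) : ℤ) = N i := Int.toNat_of_nonneg (by linarith)
    have eA' : (((A i).toNat : ℕ) : ℝ) = A i := by exact_mod_cast eA
    rw [suspensionMap_eq_of_neighbor (c' := A (i + 1)) (x' := N (i + 1)) (by omega) (by omega)
      (h.le (i + 1)) (by rw [eA]; exact h.lt_add i) (by rw [eA, eN]; exact h.det i), eA']

end IsFareyChain

/-- Take `x` to represent $-p^{-1}$ modulo `q`. Then `x < q` yields `q * y ≤ (q - 1) * p + 1 ≤ q *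
p`. -/
lemma exists_unimodular {p q : ℕ} (hp : 0 < p) (hq : 0 < q) (hpq : Nat.Coprime p q) :
    ∃ x y : ℕ, y ≤ p ∧ y * q = x * p + 1 := by
  have : NeZero q := ⟨hq.ne'⟩
  set x := (-(p : ZMod q)⁻¹).val with hx
  have hxq : x < q := ZMod.val_lt _
  have h1 : ((x * p + 1 : ℕ) : ZMod q) = 0 := by
    push_cast
    rw [hx, ZMod.natCast_zmod_val]
    linear_combination -ZMod.coe_mul_inv_eq_one p hpq
  obtain ⟨y, hy⟩ := (ZMod.natCast_eq_zero_iff _ _).mp h1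
  refine ⟨x, y, ?_, by linarith⟩
  have h2 : q * y ≤ q * p := by
    rw [← hy]
    nlinarith
  exact Nat.le_of_mul_le_mul_left h2 hq

/-- A sequence of consecutive Farey fractions starting at `x / q` reaches `y / p`, and all
denominators in between are larger than `p` and `q`. -/
lemma exists_chain_end {p q n x y : ℕ} {A N : ℕ → ℤ} (hp : 0 < p) (hq : 0 < q) (hpn : p ≤ n)
    (hxyZ : (y : ℤ) * q = x * p + 1) (hA0 : A 0 = q) (hN0 : N 0 = x) (hApos : ∀ i, 1 ≤ A i)
    (hAle : ∀ i, A i ≤ n) (hAadd : ∀ i, (n : ℤ) < A i + A (i + 1))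
    (hNdet : ∀ i, N (i + 1) * A i - N i * A (i + 1) = 1) :
    ∃ s, 1 ≤ s ∧ A s = p ∧ N s = y ∧ ∀ m, 0 < m → m < s → (q : ℤ) < A m ∧ (p : ℤ) < A m := by
  -- `U`, `W` are the coordinates of the fraction vector in the basis formed by `x / q` and `y / p`.
  set U : ℕ → ℤ := fun i => y * A i - p * N i with hU
  set W : ℕ → ℤ := fun i => q * N i - x * A i with hW
  have hAUW : ∀ i, A i = U i * q + W i * p := by
    intro i
    simp only [hU, hW]
    linear_combination -(A i) * hxyZ
  have hUWdet : ∀ i, U i * W (i + 1) - U (i + 1) * W i = 1 := by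
    intro i
    simp only [hU, hW]
    linear_combination (y * q - x * p : ℤ) * hNdet i + hxyZ
  have hU0 : U 0 = 1 := by
    simp only [hU, hA0, hN0]
    linear_combination hxyZ
  have hW0 : W 0 = 0 := by
    simp only [hW, hA0, hN0]
    ring
  have hpnZ : (p : ℤ) ≤ n := by exact_mod_cast hpn
  -- The chain cannot jump over `y / p`: if `U` became negative, `p` would be at least `A i + A (i +
  -- 1) > n`.
  have step : ∀ i, 1 ≤ U i → 0 ≤ W i → 0 ≤ U (i + 1) ∧ 1 ≤ W (i + 1) := by
    intro i h1 h2
    have h3 : 0 ≤ U (i + 1) := by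
      by_contra hcon
      have h4 : 1 ≤ -U (i + 1) := by linarith [Int.add_one_le_of_lt (not_le.mp hcon)]
      have e : (p : ℤ) = -U (i + 1) * A i + U i * A (i + 1) := by
        rw [hAUW i, hAUW (i + 1)]
        linear_combination -(p : ℤ) * hUWdet i
      nlinarith [hApos i, hApos (i + 1), hAadd i]
    refine ⟨h3, ?_⟩
    have h4 : 0 < U i * W (i + 1) := by nlinarith [hUWdet i, mul_nonneg h3 h2]
    have := pos_of_mul_pos_right h4 (by linarith)
    linarith
  -- Otherwise infinitely many distinct integer points, ordered by the slope `W / U`, would lie in a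
  -- square of side `n`.
  have hterm : ∃ i, U i < 1 := by
    by_contra hcon
    push Not at hcon
    have hWnn : ∀ i, 0 ≤ W i := by
      intro i
      induction i with
      | zero => rw [hW0]
      | succ i ih => linarith [(step i (hcon i) ih).2]
    have hUle : ∀ i, U i ≤ n := by
      intro i
      have h1 : U i * 1 ≤ U i * q :=
        mul_le_mul_of_nonneg_left (by exact_mod_cast hq) (by linarith [hcon i])
      have h2 : 0 ≤ W i * p := mul_nonneg (hWnn i) (by positivity)
      linarith [hAUW i, hAle i]
    have hWle : ∀ i, W i ≤ n := by
      intro i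
      have h1 : W i * 1 ≤ W i * p := mul_le_mul_of_nonneg_left (by exact_mod_cast hp) (hWnn i)
      have h2 : 0 ≤ U i * q := mul_nonneg (by linarith [hcon i]) (by positivity)
      linarith [hAUW i, hAle i]
    have hmono : StrictMono fun i => (W i : ℚ) / U i := by
      refine strictMono_nat_of_lt_succ fun i => ?_
      have h1 : (0 : ℚ) < U i := by exact_mod_cast hcon i
      have h2 : (0 : ℚ) < U (i + 1) := by exact_mod_cast hcon (i + 1)
      rw [div_lt_div_iff₀ h1 h2]
      have h3 : W i * U (i + 1) < W (i + 1) * U i := by linarith [hUWdet i]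
      exact_mod_cast h3
    have hinj : Function.Injective fun i => (U i, W i) := by
      intro i j hij
      simp only [Prod.mk.injEq] at hij
      apply hmono.injective
      simp only [hij.1, hij.2]
    have hfin : (Set.range fun i => (U i, W i)).Finite := by
      refine ((Set.finite_Icc (0 : ℤ) n).prod (Set.finite_Icc (0 : ℤ) n)).subset ?_
      rintro _ ⟨i, rfl⟩
      exact ⟨⟨by linarith [hcon i], hUle i⟩, ⟨hWnn i, hWle i⟩⟩
    exact Set.infinite_range_of_injective hinj hfin
  classical
  set s := Nat.find hterm with hs
  have hsU : U s < 1 := Nat.find_spec hterm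
  have hbefore : ∀ i, i < s → 1 ≤ U i := fun i hi => not_lt.mp (Nat.find_min hterm hi)
  have hs0 : s ≠ 0 := by
    intro e
    rw [e, hU0] at hsU
    exact lt_irrefl _ hsU
  have hWs : ∀ i, i ≤ s → 0 ≤ W i := by
    intro i
    induction i with
    | zero => intro _; rw [hW0]
    | succ i ih => intro hi; linarith [(step i (hbefore i (by omega)) (ih (by omega))).2]
  have hWpos : ∀ i, 1 ≤ i → i ≤ s → 1 ≤ W i := by
    intro i hi his
    obtain ⟨j, rfl⟩ := Nat.exists_eq_succ_of_ne_zero (by omega : i ≠ 0)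
    exact (step j (hbefore j (by omega)) (hWs j (by omega))).2
  obtain ⟨t, ht⟩ := Nat.exists_eq_succ_of_ne_zero hs0
  have hUs : U s = 0 := by
    have := (step t (hbefore t (by omega)) (hWs t (by omega))).1
    rw [ht] at hsU ⊢
    simp only [Nat.succ_eq_add_one] at hsU ⊢
    linarith
  have hWs1 : W s = 1 := by
    have h1 := hUWdet t
    rw [ht, Nat.succ_eq_add_one] at hUs
    rw [hUs, zero_mul, sub_zero] at h1
    have h2 := Int.eq_one_or_neg_one_of_mul_eq_one' h1
    have h3 := hbefore t (by omega)
    rw [ht, Nat.succ_eq_add_one]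
    rcases h2 with h2 | h2
    · exact h2.2
    · omega
  have hAs : A s = p := by rw [hAUW, hUs, hWs1]; ring
  have hNs : N s = y := by
    have h1 : (y : ℤ) * A s - p * N s = 0 := hUs
    rw [hAs] at h1
    have hp0 : (p : ℤ) ≠ 0 := by exact_mod_cast hp.ne'
    have h2 : (p : ℤ) * N s = p * y := by linarith
    exact mul_left_cancel₀ hp0 h2
  refine ⟨s, by omega, hAs, hNs, fun m hm0 hms => ?_⟩
  have h1 := hbefore m hms
  have h2 := hWpos m hm0 hms.le
  have hpZ : (0 : ℤ) < p := by exact_mod_cast hp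
  have hqZ : (0 : ℤ) < q := by exact_mod_cast hq
  have g1 : (q : ℤ) ≤ U m * q := by nlinarith
  have g2 : (p : ℤ) ≤ W m * p := by nlinarith
  rw [hAUW]
  exact ⟨by linarith, by linarith⟩

/-- The excursion from `q / n` to `p / n` runs through the Farey fractions of order `n` between
`x / q` and `y / p`. -/
lemma exists_excursion {p q n x y : ℕ} (hp : 0 < p) (hq : 0 < q) (hn : max p q ≤ n)
    (hxy : y * q = x * p + 1) :
    ∃ (e : Excursion) (A N : ℕ → ℤ), e.Corresponds ((q : ℝ) / n) ((p : ℝ) / n) ∧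
      IsFareyChain n p q x y e.len A N ∧
      ∀ i, e.point i = ((A i : ℝ) / n, (A (i + 1) : ℝ) / n) := by
  have hpn : p ≤ n := le_of_max_le_left hn
  have hqn : q ≤ n := le_of_max_le_right hn
  have hqR : (0 : ℝ) < q := by exact_mod_cast hq
  have hpR : (0 : ℝ) < p := by exact_mod_cast hp
  have hqnR : (q : ℝ) ≤ n := by exact_mod_cast hqn
  have hnR : (0 : ℝ) < n := hqR.trans_le hqnR
  -- `B` is the element of `(n - q, n]` congruent to `p` modulo `q`: the denominator of the
  -- successor of `x / q`, whose numerator is `y + k * x`.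
  set k : ℕ := (n - p) / q with hk
  set B : ℕ := p + k * q with hB
  have hB1 : B ≤ n := by
    have := Nat.div_mul_le_self (n - p) q
    rw [← hk] at this
    omega
  have hB2 : n < q + B := by
    have := Nat.lt_div_mul_add (a := n - p) hq
    rw [← hk] at this
    omega
  set v : ℝ × ℝ := ((q : ℝ) / n, (B : ℝ) / n) with hv
  have hvmem : v ∈ fareyTriangle := by
    have hBpos : (0 : ℝ) < B := by exact_mod_cast (by omega : 0 < B)
    refine ⟨div_pos hqR hnR, (div_le_one hnR).mpr hqnR, div_pos hBpos hnR,
      (div_le_one hnR).mpr (by exact_mod_cast hB1), ?_⟩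
    change 1 < (q : ℝ) / n + (B : ℝ) / n
    rw [← add_div, one_lt_div hnR]
    exact_mod_cast hB2
  obtain ⟨α, β, hα0, hβ0, hα1, hβ1, hlin, hdet⟩ := exists_coords v
  set A : ℕ → ℤ := fun i => α i * q + β i * B with hA
  set N : ℕ → ℤ := fun i => α i * x + β i * (y + k * x) with hN
  have hxyZ : (y : ℤ) * q = x * p + 1 := by exact_mod_cast hxy
  have hfst : ∀ i, (bczMap^[i] v).1 = (A i : ℝ) / n := by
    intro i
    rw [hlin, hA, hv]
    push_cast
    ring
  have hpt : ∀ i, bczMap^[i] v = ((A i : ℝ) / n, (A (i + 1) : ℝ) / n) := fun i =>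
    Prod.ext (hfst i) (by rw [iterate_bczMap_snd, hfst])
  have hApos : ∀ i, 1 ≤ A i := by
    intro i
    have := (iterate_bczMap_mem hvmem i).1
    rw [hfst, div_pos_iff_of_pos_right hnR] at this
    have h0 : 0 < A i := by exact_mod_cast this
    linarith
  have hAle : ∀ i, A i ≤ n := by
    intro i
    have := (iterate_bczMap_mem hvmem i).2.1
    rw [hfst, div_le_one hnR] at this
    exact_mod_cast this
  have hAadd : ∀ i, (n : ℤ) < A i + A (i + 1) := by
    intro i
    have := (iterate_bczMap_mem hvmem i).2.2.2.2
    rw [hpt, ← add_div, one_lt_div hnR] at this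
    exact_mod_cast this
  have hBZ : (B : ℤ) = p + k * q := by rw [hB]; push_cast; ring
  have hNdet : ∀ i, N (i + 1) * A i - N i * A (i + 1) = 1 := by
    intro i
    simp only [hA, hN, hBZ]
    linear_combination (y * q - x * p : ℤ) * hdet i + hxyZ
  have hA0 : A 0 = q := by simp [hA, hα0, hβ0]
  have hN0 : N 0 = x := by simp [hN, hα0, hβ0]
  obtain ⟨s, hs0, hAs, hNs, hbig⟩ := exists_chain_end hp hq hpn hxyZ hA0 hN0 hApos hAle hAadd hNdet
  have hdeep : ∀ m : ℕ, 0 < m → m < s →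
      1 / (bczMap^[m] v).1 < 1 / v.1 ∧ 1 / (bczMap^[m] v).1 < 1 / (bczMap^[s] v).1 := by
    intro m hm0 hms
    obtain ⟨h3, h4⟩ := hbig m hm0 hms
    have h3' : (q : ℝ) < A m := by exact_mod_cast h3
    have h4' : (p : ℝ) < A m := by exact_mod_cast h4
    rw [hfst, hfst, hAs]
    constructor
    · refine one_div_lt_one_div_of_lt (div_pos hqR hnR) ?_
      change (q : ℝ) / n < _
      gcongr
    · refine one_div_lt_one_div_of_lt (div_pos (by simpa using hpR) hnR) ?_
      simp only [Int.cast_natCast]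
      gcongr
  refine ⟨⟨v, s, hvmem, hs0, hdeep⟩, A, N, ⟨rfl, ?_⟩, ⟨hA0, hN0, hAs, hNs, hApos, hAle, hAadd,
    hNdet⟩, hpt⟩
  change (bczMap^[s] v).1 = _
  rw [hfst, hAs]
  simp

/-- The half-open interval contains the final fraction `y / p` but not `x / q`, so the starting
point is split off. -/
lemma Excursion.sum_eq {p q n x y : ℕ} (hp : 0 < p) (hq : 0 < q) (hn : max p q ≤ n)
    (hyp : y ≤ p) (hxy : y * q = x * p + 1) {e : Excursion}
    (he : e.Corresponds ((q : ℝ) / n) ((p : ℝ) / n)) (f : ℝ × ℝ → ℝ) :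
    e.sum f = f e.start + ∑ z ∈ intervalPairs ((x : ℝ) / q) ((y : ℝ) / p) n,
      f (suspensionMap (scaledPoint n z)) := by
  obtain ⟨e', A, N, he', hchain, hpt⟩ := exists_excursion hp hq hn hxy
  obtain rfl := Excursion.eq_of_corresponds he he'
  rw [← hchain.sum_eq hp hq hyp f, Excursion.sum, Finset.sum_range_eq_add_Ico _ (by omega)]
  congr 1
  refine Finset.sum_congr ?_ fun i _ => by rw [hpt]
  ext i
  simp only [Finset.mem_Ico, Finset.mem_Icc]
  omega

end ExcursionSums

theorem theorem4p6 (f : ℝ × ℝ → ℝ)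
    (hf : PiecewiseContinuousOn f fareyTriangle)
    (hbdd : ∃ C : ℝ, ∀ x ∈ fareyTriangle, |f x| ≤ C)
    (p q : ℕ) (hp : 0 < p) (hq : 0 < q) (hpq : Nat.Coprime p q) :
    (∀ n : ℕ, max p q ≤ n →
      ∃! e : Excursion, e.Corresponds ((q : ℝ) / (n : ℝ)) ((p : ℝ) / (n : ℝ))) ∧
    Integrable f fareyMeasure ∧
    ∀ e : ℕ → Excursion,
      (∀ n : ℕ, max p q ≤ n → (e n).Corresponds ((q : ℝ) / (n : ℝ)) ((p : ℝ) / (n : ℝ))) →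
      Tendsto (fun n : ℕ => ((p : ℝ) * (q : ℝ) / (fareyIndex n : ℝ)) * (e n).sum f) atTop
        (𝓝 (∫ x, f x ∂fareyMeasure)) := by
  obtain ⟨C, hC⟩ := hbdd
  obtain ⟨x, y, hyp, hxy⟩ := exists_unimodular hp hq hpq
  refine ⟨fun n hn => ?_, integrable_of_piecewiseContinuousOn hf hC, fun e he => ?_⟩
  · obtain ⟨e, A, N, he, -⟩ := exists_excursion hp hq hn hxy
    exact ⟨e, he, fun e' he' => Excursion.eq_of_corresponds he' he⟩
  have hqR : (0 : ℝ) < q := by exact_mod_cast hq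
  have hpR : (0 : ℝ) < p := by exact_mod_cast hp
  have hxyR : (y : ℝ) * q = x * p + 1 := by exact_mod_cast hxy
  have hdiff : (y : ℝ) / p - (x : ℝ) / q = 1 / (p * q) := by
    field_simp
    linarith
  have hlt : (x : ℝ) / q < (y : ℝ) / p := by
    rw [← sub_pos, hdiff]; positivity
  have hmain := tendsto_sum_div_totientSum hf hC (ξ := (x : ℝ) / q) (η := (y : ℝ) / p)
    (by positivity) hlt ((div_le_one hpR).mpr (by exact_mod_cast hyp))
  rw [hdiff] at hmain
  have htot : Tendsto (fun n : ℕ => (totientSum n : ℝ)) atTop atTop := by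
    have h1 : Tendsto (fun n : ℕ => (n : ℝ) ^ 2) atTop atTop :=
      (tendsto_pow_atTop (by norm_num)).comp tendsto_natCast_atTop_atTop
    refine (tendsto_totientSum.pos_mul_atTop halfCoprimeDensity_pos h1).congr' ?_
    filter_upwards [eventually_gt_atTop 0] with n hn
    have : (n : ℝ) ≠ 0 := by exact_mod_cast hn.ne'
    field_simp
  -- The starting point contributes a bounded term, negligible against the number of Farey
  -- fractions.
  have hstart : Tendsto (fun n : ℕ => f (e n).start / (totientSum n : ℝ)) atTop (𝓝 0) := by
    refine squeeze_zero_norm (a := fun n : ℕ => C / (totientSum n : ℝ)) (fun n => ?_)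
      (htot.const_div_atTop C)
    rw [norm_div, Real.norm_eq_abs, Real.norm_natCast]
    gcongr
    exact hC _ (e n).start_mem
  have hsum := (hstart.add hmain).const_mul ((p : ℝ) * q)
  have e1 : (p : ℝ) * q * (0 + 1 / (p * q) * ∫ x, f x ∂fareyMeasure) =
      ∫ x, f x ∂fareyMeasure := by
    field_simp; ring
  rw [e1] at hsum
  refine hsum.congr' ?_
  filter_upwards [eventually_ge_atTop (max p q)] with n hn
  have hn0 : 0 < n := by have := le_of_max_le_left hn; omega
  rw [Excursion.sum_eq hp hq hn hyp hxy (he n hn), fareyIndex_eq_totientSum hn0]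
  ring
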